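/- **Setting.** Let $d\ge 2$, $\rho,\nu,r>0$, $N\in\mathbb N$, $N\ge1$, and let $\{x_m^\omega\}_m$ be a Poisson point process on $\mathbb R^d$ with constant intensity $\nu$, defined on a probability space $\Omega$, with locally finite realizations. Let $\Lambda_N=(-L_N/2,L_N/2)^d$ with $L_N=\rho^{-1/d}N^{1/d}$, and let $\Lambda_N^\omega=\Lambda_N\setminus\bigcup_m B_r(x_m^\omega)$ (closed balls) be the vacancy set. Let $v_N\in (L^1\cap L^\infty)(\mathbb R^d)$ be nonnegative and even with nonnegative, integrable Fourier transform. For open $U\subset\mathbb R^d$, functions in $H_0^1(U)$ are complex-valued and extended by zero. Let $\lambda_N^{1,\omega}\le\lambda_N^{2,\omega}\le\dots$ be the eigenvalues, counted with multiplicity, of the Dirichlet Laplacian $-\Delta$ on $\Lambda_N^\omega$. Write $\omega_d$ for the volume of the unit ball of $\mathbb R^d$. For $0<\eta<e^{-\nu\omega_d r^d}$ let $\Omega_N^{(1),\eta}$ be the set of $\omega\in\Omega$ with $\big||\Lambda_N^\omega|/|\Lambda_N|-e^{-\nu\omega_dr^d}\big|<\eta$, and $$\Omega_N^{(2),\eta}=\Big\{\omega\in\Omega_N^{(1),\eta}:\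 \lambda_N^{2,\omega}-\lambda_N^{1,\omega}>C_1^2\,N\,\|v_N\|_1\,(\lambda_N^{1,\omega})^{d/2}\Big\},\qquad C_1=2(4\pi)^{-d/4}e .$$ For a component $\Lambda_N^{k,\omega}$ of $\Lambda_N^\omega$ let, on $H_0^1(\Lambda_N^{k,\omega})$, $$\mathcal E_N^{k,\omega}[\psi]=\int|\nabla\psi|^2+\frac{N-1}2\iint v_N(x-y)|\psi(x)|^2|\psi(y)|^2\,dx\,dy ,$$ and for $u\in H^1_0(\Lambda_N^\omega)$ let $$h_N^{u,\omega}=-\Delta+(N-1)(|u|^2*v_N)-\frac{N-1}2\iint v_N(x-y)|u(x)|^2|u(y)|^2\,dx\,dy$$ with form domain $H_0^1(\Lambda_N^\omega)$. Let $h_N^{u,k,\omega}$ be given by the same expression with form domain $H_0^1(\Lambda_N^{k,\omega})$, and let $e_N^{1,u,k,\omega}$ be its lowest eigenvalue. **Lemma.** Let $0<\eta<e^{-\nu\omega_dr^d}$ and $\omega\in\Omega_N^{(2),\eta}$. There is exactly one component $\Lambda_N^{\tilde k,\omega}$ of $\Lambda_N^\omega$ outside of which some normalized eigenfunction of the Dirichlet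 Laplacian on $\Lambda_N^\omega$ for the eigenvalue $\lambda_N^{1,\omega}$ vanishes almost everywhere. On this component, $\mathcal E_N^{\tilde k,\omega}$ has a minimizer among the functions $\psi\in H_0^1(\Lambda_N^{\tilde k,\omega})$ with $\|\psi\|_2=1$. For every such minimizer $\tilde u$, $$e_N^{1,\tilde u,\tilde k,\omega}=\min\Big\{\langle\psi, h_N^{\tilde u,\omega}\psi\rangle:\ \psi\in H_0^1(\Lambda_N^\omega),\ \|\psi\|_2=1\Big\},$$ where $\langle\psi,h_N^{\tilde u,\omega}\psi\rangle$ is understood in the form sense, and the minimum is attained. -/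

import Mathlib

open MeasureTheory ProbabilityTheory Filter Topology
open scoped FourierTransform ComplexConjugate NNReal

noncomputable section

namespace KacLuttinger

/-- Euclidean space `ℝ^d`. -/
abbrev E (d : ℕ) : Type := EuclideanSpace ℝ (Fin d)

/-! ### The Kac-Luttinger model -/

/-- `X` is a homogeneous Poisson point process on `ℝ^d` with intensity `ν`: a random locally finite
set whose numbers of points in pairwise disjoint bounded Borel sets are independent, the number of
points in `B` being Poisson distributed with mean `ν |B|`. -/
structure IsPoissonPointProcess {d : ℕ} {Ω : Type*} [MeasurableSpace Ω] (P : Measure Ω)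
    (ν : ℝ≥0) (X : Ω → Set (E d)) : Prop where
  locallyFinite : ∀ ω, ∀ B : Set (E d), Bornology.IsBounded B → (X ω ∩ B).Finite
  measurable_count : ∀ B : Set (E d), MeasurableSet B → Bornology.IsBounded B →
    Measurable fun ω => (X ω ∩ B).ncard
  law_count : ∀ B : Set (E d), MeasurableSet B → Bornology.IsBounded B →
    P.map (fun ω => (X ω ∩ B).ncard) = poissonMeasure (ν * (volume B).toNNReal)
  indep_count : ∀ (n : ℕ) (B : Fin n → Set (E d)), (∀ i, MeasurableSet (B i)) →
    (∀ i, Bornology.IsBounded (B i)) → Pairwise (fun i j => Disjoint (B i) (B j)) →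
    iIndepFun (fun i ω => (X ω ∩ B i).ncard) P

/-- The open box `Λ_N = (-L_N/2, L_N/2)^d` with `L_N = ρ^(-1/d) N^(1/d)`. -/
def box (d : ℕ) (ρ : ℝ) (N : ℕ) : Set (E d) :=
  {x | ∀ i, x i ∈ Set.Ioo (-(ρ ^ (-1 / (d : ℝ)) * (N : ℝ) ^ (1 / (d : ℝ))) / 2)
    ((ρ ^ (-1 / (d : ℝ)) * (N : ℝ) ^ (1 / (d : ℝ))) / 2)}

/-- The vacancy set: the box without the closed balls of radius `r` around the points of `S`. -/
def vacancySet {d : ℕ} (ρ : ℝ) (N : ℕ) (r : ℝ) (S : Set (E d)) : Set (E d) :=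
  box d ρ N \ ⋃ p ∈ S, Metric.closedBall p r

/-- The set of connected components of `U`. -/
def components {d : ℕ} (U : Set (E d)) : Set (Set (E d)) :=
  {C | ∃ x ∈ U, C = connectedComponentIn U x}

/-- `exp (-ν ω_d r^d)`, where `ω_d` is the volume of the unit ball of `ℝ^d`. -/
def vacancyFraction (d : ℕ) (ν : ℝ≥0) (r : ℝ) : ℝ :=
  Real.exp (-((ν : ℝ) * volume.real (Metric.ball (0 : E d) 1) * r ^ d))

/-- The event `Ω_N^(1),η`. -/
def event1 {d : ℕ} {Ω : Type*} (X : Ω → Set (E d)) (ν : ℝ≥0) (ρ r η : ℝ) (N : ℕ) : Set Ω :=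
  {ω | |volume.real (vacancySet ρ N r (X ω)) / volume.real (box d ρ N)
      - vacancyFraction d ν r| < η}

/-- Standing assumptions on the pair interaction (`v` is `v_N` for the given `N`). -/
structure IsInteraction {d : ℕ} (v : E d → ℝ) : Prop where
  integrable : Integrable v
  essBounded : MemLp v ⊤
  nonneg : ∀ x, 0 ≤ v x
  even : ∀ x, v (-x) = v x
  fourier_real : ∀ ξ, (𝓕 (fun x => (v x : ℂ)) ξ).im = 0
  fourier_nonneg : ∀ ξ, 0 ≤ (𝓕 (fun x => (v x : ℂ)) ξ).re
  fourier_integrable : Integrable (𝓕 (fun x => (v x : ℂ)))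

/-! ### The space `H^1_0(U)` -/

/-- `L^2(ℝ^d; ℂ)`. -/
abbrev L2 (d : ℕ) : Type := Lp ℂ 2 (volume : Measure (E d))

/-- The Hilbert space of pairs (function, gradient), with squared norm
`‖f‖_2 ^ 2 + ∑ i, ‖g i‖_2 ^ 2`. -/
abbrev Pair (d : ℕ) : Type := WithLp 2 (L2 d × PiLp 2 (fun _ : Fin d => L2 d))

/-- `p = (φ, ∇φ)` for some test function `φ ∈ C_c^∞(U; ℂ)`. -/
def IsTestPair {d : ℕ} (U : Set (E d)) (p : Pair d) : Prop :=
  ∃ φ : E d → ℂ, ContDiff ℝ ((⊤ : ℕ∞) : WithTop ℕ∞) φ ∧ HasCompactSupport φ ∧ tsupport φ ⊆ U ∧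
    (p.fst : E d → ℂ) =ᵐ[volume] φ ∧
    ∀ i, (p.snd i : E d → ℂ) =ᵐ[volume]
      fun x => fderiv ℝ φ x (EuclideanSpace.single i (1 : ℝ))

/-- `H^1_0(U)`, the closure of `C_c^∞(U)` in the `H^1` norm. Its elements are recorded as pairs
`(ψ, ∇ψ)` extended by zero to `ℝ^d`; the gradient is determined by `ψ`. Since both vanish almost
everywhere outside `U`, integrals over `U` and over `ℝ^d` agree. -/
def H10 {d : ℕ} (U : Set (E d)) : Submodule ℂ (Pair d) :=
  (Submodule.span ℂ {p | IsTestPair U p}).topologicalClosure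

/-! ### Schrödinger operators `-Δ + W` with Dirichlet boundary conditions -/

/-- The sesquilinear form `∫ conj ∇ψ · ∇χ + ∫ W conj ψ χ` of `-Δ + W`. -/
def form {d : ℕ} (W : E d → ℝ) (ψ χ : Pair d) : ℂ :=
  (∑ i, ∫ x, conj (ψ.snd i x) * χ.snd i x) + ∫ x, (W x : ℂ) * (conj (ψ.fst x) * χ.fst x)

/-- The energy `⟨ψ, (-Δ + W) ψ⟩` in the form sense. -/
def energy {d : ℕ} (W : E d → ℝ) (ψ : Pair d) : ℝ :=
  (∑ i, ∫ x, ‖ψ.snd i x‖ ^ 2) + ∫ x, W x * ‖ψ.fst x‖ ^ 2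

/-- `ψ ∈ H^1_0(U)` solves `(-Δ + W) ψ = lam ψ` in the form sense. -/
def IsEigenvector {d : ℕ} (U : Set (E d)) (W : E d → ℝ) (lam : ℝ) (ψ : Pair d) : Prop :=
  ψ ∈ H10 U ∧ ∀ χ ∈ H10 U, form W χ ψ = (lam : ℂ) * ∫ x, conj (χ.fst x) * ψ.fst x

/-- The `n`-th eigenvalue (`n = 1, 2, …`), in increasing order and counted with multiplicity, of
`-Δ + W` on `U`: the smallest `lam` for which there are `n` linearly independent eigenfunctions
with eigenvalues at most `lam`. -/
def eigenvalue {d : ℕ} (U : Set (E d)) (W : E d → ℝ) (n : ℕ) : ℝ :=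
  sInf {lam : ℝ | ∃ ψ : Fin n → Pair d, LinearIndependent ℂ ψ ∧
    ∀ i, ∃ μ ≤ lam, IsEigenvector U W μ (ψ i)}

/-- The `n`-th eigenvalue of the Dirichlet Laplacian on `U`. -/
def laplacianEigenvalue {d : ℕ} (U : Set (E d)) (n : ℕ) : ℝ := eigenvalue U (fun _ => 0) n

/-- `φ` is an `L^2`-normalized eigenfunction for the lowest eigenvalue of `-Δ` on `U`. -/
def IsLaplacianGroundState {d : ℕ} (U : Set (E d)) (φ : Pair d) : Prop :=
  IsEigenvector U (fun _ => 0) (laplacianEigenvalue U 1) φ ∧ ‖φ.fst‖ = 1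

/-- `C` is a component of `U` that carries a ground state of the Dirichlet Laplacian on `U`. -/
def IsGroundComponent {d : ℕ} (U C : Set (E d)) : Prop :=
  C ∈ components U ∧ ∃ φ, IsLaplacianGroundState U φ ∧ ∀ᵐ x, x ∉ C → φ.fst x = 0

/-- The constant `C_1 = 2 (4π)^(-d/4) e`. -/
def C1 (d : ℕ) : ℝ := 2 * (4 * Real.pi) ^ (-(d : ℝ) / 4) * Real.exp 1

/-- The event `Ω_N^(2),η`. -/
def event2 {d : ℕ} {Ω : Type*} (X : Ω → Set (E d)) (ν : ℝ≥0) (ρ r η : ℝ) (N : ℕ)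
    (v : E d → ℝ) : Set Ω :=
  {ω | ω ∈ event1 X ν ρ r η N ∧
    laplacianEigenvalue (vacancySet ρ N r (X ω)) 2 - laplacianEigenvalue (vacancySet ρ N r (X ω)) 1
      > C1 d ^ 2 * N * (∫ x, ‖v x‖) *
        laplacianEigenvalue (vacancySet ρ N r (X ω)) 1 ^ ((d : ℝ) / 2)}

/-! ### Hartree functional and mean-field operator -/

/-- `∫ ∫ v(x-y) |u(x)|^2 |u(y)|^2 dx dy`. -/
def selfInteraction {d : ℕ} (v : E d → ℝ) (u : Pair d) : ℝ :=
  ∫ x, ∫ y, v (x - y) * ‖u.fst x‖ ^ 2 * ‖u.fst y‖ ^ 2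

/-- The Hartree functional
`∫ |∇ψ|^2 + (N-1)/2 ∫ ∫ v(x-y) |ψ(x)|^2 |ψ(y)|^2 dx dy`. -/
def hartree {d : ℕ} (N : ℕ) (v : E d → ℝ) (ψ : Pair d) : ℝ :=
  (∑ i, ∫ x, ‖ψ.snd i x‖ ^ 2) + ((N : ℝ) - 1) / 2 * selfInteraction v ψ

/-- `u` minimizes the Hartree functional among the normalized elements of `H^1_0(C)`. -/
def IsHartreeMinimizer {d : ℕ} (N : ℕ) (v : E d → ℝ) (C : Set (E d)) (u : Pair d) : Prop :=
  u ∈ H10 C ∧ ‖u.fst‖ = 1 ∧ ∀ ψ ∈ H10 C, ‖ψ.fst‖ = 1 → hartree N v u ≤ hartree N v ψ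

/-- The potential `(N-1) (|u|^2 * v) - (N-1)/2 ∫ ∫ v(x-y) |u(x)|^2 |u(y)|^2 dx dy` of the mean-field
operator `h_N^u`. -/
def meanField {d : ℕ} (N : ℕ) (v : E d → ℝ) (u : Pair d) (x : E d) : ℝ :=
  ((N : ℝ) - 1) * (∫ y, v (x - y) * ‖u.fst y‖ ^ 2) - ((N : ℝ) - 1) / 2 * selfInteraction v u

end KacLuttinger

end

/-! Write `l₁ < l₂` for the first two Dirichlet eigenvalues of the vacancy set `U`, `S` for the
self-interaction, `C` for the ground component and `φ` for a normalized ground state carried by `C`.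
A normalized `ψ` in `H^1_0(U)` splits orthogonally, both in `L^2` and in the form of the mean-field
operator, into its parts on `C` and on `U \ C`. On `C` the form is at least `e`, the lowest
eigenvalue there, times the mass. On `U \ C` the kinetic energy is at least `l₂` times the mass, and
the nonnegative convolution term can be dropped, so it suffices that `e ≤ l₂ - (N-1)/2 S(u)`.

For this, test with the minimizer: `e ≤ ⟨u, h u⟩`, which is the Hartree energy of `u` and hence at
most that of `φ`, namely `l₁ + (N-1)/2 S(φ)`. Since `‖∇u‖² ≥ l₁`, the same comparison gives `(N-1)/2
S(u) ≤ (N-1)/2 S(φ)`. Adding the two, the claim follows from `(N-1) S(φ) < l₂ - l₁`. Young's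
inequality bounds `S(φ)` by `‖v‖_1 ‖φ‖_4^4`, and an `L^4` bound of order `l₁^(d/2)` for
eigenfunctions meets the gap condition.

The analytic core is a Nash-type inequality, `three_mul_norm_sq_le`: `3‖f‖² ≤ 2t‖∇f‖² + e² ∫ |f̂|²
e^(-8π²t|ξ|²)`. It is used three times. Its last term is continuous under weak convergence on sets
of finite measure, which yields Rellich's theorem and so all minimizers; bounding that term by
`‖f‖_1²` shows that Dirichlet eigenvalues are positive; and applied to a truncation of `|φ|²`, whose
gradient is controlled by testing the eigenvalue equation with a truncation of `|φ|²φ`, it gives the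
`L^4` bound `lintegral_norm_pow_four_le`.

A ground component exists because cutting a ground state to a component leaves an eigenfunction or
zero, and there are only countably many components. It is unique because ground states on two
components would be linearly independent, forcing `l₂ ≤ l₁`. -/

noncomputable section

namespace KacLuttinger

variable {d : ℕ}

/-! ### The forms in terms of inner products -/

/-- Multiplication by an essentially bounded function, as an operator on `L^2`. -/
def mulL (m : E d → ℂ) (hm : MemLp m ⊤) : L2 d →L[ℂ] L2 d :=
  (ContinuousLinearMap.mul ℂ ℂ).holderL volume ⊤ 2 2 (hm.toLp m)

lemma coeFn_mulL (m : E d → ℂ) (hm : MemLp m ⊤) (f : L2 d) :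
    mulL m hm f =ᵐ[volume] fun x => m x * f x := by
  have h := (ContinuousLinearMap.mul ℂ ℂ).coeFn_holder (r := 2) (hm.toLp m) f
  filter_upwards [h, hm.coeFn_toLp] with x h1 h2
  rw [h2] at h1
  exact h1

lemma inner_L2_eq (f g : L2 d) : inner ℂ f g = ∫ x, conj (f x) * g x := by
  rw [L2.inner_def]
  refine integral_congr_ae (ae_of_all _ fun x => ?_)
  simp [mul_comm]

lemma integral_norm_sq_L2 (f : L2 d) : ∫ x, ‖f x‖ ^ 2 = ‖f‖ ^ 2 := by
  have h := inner_self_eq_norm_sq_to_K (𝕜 := ℂ) f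
  rw [L2.inner_def] at h
  simp only [inner_self_eq_norm_sq_to_K] at h
  have h2 : ∀ x, ((‖f x‖ : ℂ)) ^ 2 = ((‖f x‖ ^ 2 : ℝ) : ℂ) := by intro x; push_cast; rfl
  simp only [Complex.coe_algebraMap, h2] at h
  rw [integral_complex_ofReal] at h
  exact_mod_cast h

lemma integrable_norm_sq_L2 (f : L2 d) : Integrable fun x => ‖f x‖ ^ 2 :=
  (memLp_two_iff_integrable_sq_norm (Lp.aestronglyMeasurable f)).1 (Lp.memLp f)

lemma sum_integral_snd (p : Pair d) : ∑ i, ∫ x, ‖p.snd i x‖ ^ 2 = ‖p.snd‖ ^ 2 := by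
  rw [PiLp.norm_sq_eq_of_L2]
  exact Finset.sum_congr rfl fun i _ => integral_norm_sq_L2 _

lemma memLp_ofReal {W : E d → ℝ} (hW : MemLp W ⊤) : MemLp (fun x => (W x : ℂ)) ⊤ :=
  hW.ofReal

/-- For bounded `W` both terms are inner products in `L^2`, so sesquilinearity of the form needs no
integrability arguments. -/
lemma form_eq {W : E d → ℝ} (hW : MemLp W ⊤) (ψ χ : Pair d) :
    form W ψ χ = inner ℂ ψ.snd χ.snd
      + inner ℂ ψ.fst (mulL (fun x => (W x : ℂ)) (memLp_ofReal hW) χ.fst) := by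
  rw [form, PiLp.inner_apply, inner_L2_eq]
  congr 1
  · exact Finset.sum_congr rfl fun i _ => (inner_L2_eq _ _).symm
  · refine integral_congr_ae ?_
    filter_upwards [coeFn_mulL _ (memLp_ofReal hW) χ.fst] with x hx
    rw [hx]; ring

lemma energy_eq (W : E d → ℝ) (ψ : Pair d) :
    energy W ψ = ‖ψ.snd‖ ^ 2 + ∫ x, W x * ‖ψ.fst x‖ ^ 2 := by
  rw [energy, sum_integral_snd]

lemma form_self (W : E d → ℝ) (ψ : Pair d) : form W ψ ψ = (energy W ψ : ℂ) := by
  have key : ∀ z : ℂ, conj z * z = ((‖z‖ ^ 2 : ℝ) : ℂ) := by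
    intro z; rw [mul_comm, Complex.mul_conj, Complex.normSq_eq_norm_sq]
  simp only [form, key, energy, ← Complex.ofReal_mul]
  simp only [integral_complex_ofReal]
  push_cast
  rfl

lemma memLp_zero_potential : MemLp (fun _ : E d => (0 : ℝ)) ⊤ := MemLp.zero'

/-! ### Test pairs and `H^1_0` -/

/-- The pair `(φ, ∇φ)` of a test function. -/
def testPair (φ : E d → ℂ) (h : ContDiff ℝ ((⊤ : ℕ∞) : WithTop ℕ∞) φ) (hc : HasCompactSupport φ) :
    Pair d :=
  WithLp.toLp 2 ((h.continuous.memLp_of_hasCompactSupport hc).toLp φ,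
    WithLp.toLp 2 fun i =>
      (((h.continuous_fderiv (by simp)).clm_apply
        (continuous_const (y := EuclideanSpace.single i (1 : ℝ)))).memLp_of_hasCompactSupport
          (hc.fderiv_apply (𝕜 := ℝ) _)).toLp
        fun x => fderiv ℝ φ x (EuclideanSpace.single i (1 : ℝ)))

lemma testPair_fst (φ : E d → ℂ) (h : ContDiff ℝ ((⊤ : ℕ∞) : WithTop ℕ∞) φ)
    (hc : HasCompactSupport φ) : ((testPair φ h hc).fst : E d → ℂ) =ᵐ[volume] φ :=
  MemLp.coeFn_toLp (h.continuous.memLp_of_hasCompactSupport hc)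

lemma testPair_snd (φ : E d → ℂ) (h : ContDiff ℝ ((⊤ : ℕ∞) : WithTop ℕ∞) φ)
    (hc : HasCompactSupport φ) (i : Fin d) : ((testPair φ h hc).snd i : E d → ℂ) =ᵐ[volume]
      fun x => fderiv ℝ φ x (EuclideanSpace.single i (1 : ℝ)) :=
  MemLp.coeFn_toLp (((h.continuous_fderiv (by simp)).clm_apply
    (continuous_const (y := EuclideanSpace.single i (1 : ℝ)))).memLp_of_hasCompactSupport
      (hc.fderiv_apply (𝕜 := ℝ) _))

lemma isTestPair_testPair {U : Set (E d)} {φ : E d → ℂ}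
    (h : ContDiff ℝ ((⊤ : ℕ∞) : WithTop ℕ∞) φ)
    (hc : HasCompactSupport φ) (hU : tsupport φ ⊆ U) : IsTestPair U (testPair φ h hc) :=
  ⟨φ, h, hc, hU, testPair_fst φ h hc, testPair_snd φ h hc⟩

lemma Pair.ext_ae {p q : Pair d} (h1 : (p.fst : E d → ℂ) =ᵐ[volume] q.fst)
    (h2 : ∀ i, (p.snd i : E d → ℂ) =ᵐ[volume] q.snd i) : p = q := by
  have e1 : p.fst = q.fst := Lp.ext h1
  have e2 : p.snd = q.snd := PiLp.ext fun i => Lp.ext (h2 i)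
  exact (WithLp.ofLp_injective 2) (Prod.ext e1 e2)

lemma IsTestPair.zero (U : Set (E d)) : IsTestPair U (0 : Pair d) := by
  refine ⟨0, contDiff_const, HasCompactSupport.zero, by simp [tsupport], ?_, fun i => ?_⟩
  · exact Lp.coeFn_zero ℂ 2 volume
  · have := Lp.coeFn_zero ℂ 2 (volume : Measure (E d))
    filter_upwards [this] with x hx
    simp

lemma IsTestPair.add {U : Set (E d)} {p q : Pair d} (hp : IsTestPair U p) (hq : IsTestPair U q) :
    IsTestPair U (p + q) := by
  obtain ⟨φ, h1, h2, h3, h4, h5⟩ := hp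
  obtain ⟨χ, k1, k2, k3, k4, k5⟩ := hq
  refine ⟨φ + χ, h1.add k1, h2.add k2, (tsupport_add φ χ).trans (Set.union_subset h3 k3), ?_,
    fun i => ?_⟩
  · filter_upwards [h4, k4, Lp.coeFn_add p.fst q.fst] with x e1 e2 e3
    rw [WithLp.add_fst, e3]; simp [e1, e2]
  · filter_upwards [h5 i, k5 i, Lp.coeFn_add (p.snd i) (q.snd i)] with x e1 e2 e3
    have : (p + q).snd i = p.snd i + q.snd i := rfl
    rw [this, e3, fderiv_add (h1.differentiable (by simp) x) (k1.differentiable (by simp) x)]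
    simp [e1, e2]

lemma IsTestPair.smul {U : Set (E d)} {p : Pair d} (hp : IsTestPair U p) (c : ℂ) :
    IsTestPair U (c • p) := by
  obtain ⟨φ, h1, h2, h3, h4, h5⟩ := hp
  refine ⟨c • φ, contDiff_const.smul h1, h2.smul_left (f := fun _ => c),
    (tsupport_smul_subset_right (fun _ => c) φ).trans h3, ?_, fun i => ?_⟩
  · filter_upwards [h4, Lp.coeFn_smul c p.fst] with x e1 e3
    rw [WithLp.smul_fst, e3]; simp [e1]
  · filter_upwards [h5 i, Lp.coeFn_smul c (p.snd i)] with x e1 e3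
    have : (c • p).snd i = c • p.snd i := rfl
    rw [this, e3, fderiv_const_smul (h1.differentiable (by simp) x)]
    simp [e1]

/-- `H^1_0(U)` is the closure of the set of test pairs. -/
lemma coe_H10 (U : Set (E d)) : (H10 U : Set (Pair d)) = closure {p | IsTestPair U p} := by
  have : (Submodule.span ℂ {p : Pair d | IsTestPair U p} : Set (Pair d)) = {p | IsTestPair U p} := by
    let S : Submodule ℂ (Pair d) :=
      { carrier := {p | IsTestPair U p}
        add_mem' := fun hp hq => IsTestPair.add hp hq
        zero_mem' := IsTestPair.zero U
        smul_mem' := fun c _ hp => IsTestPair.smul hp c }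
    exact congrArg (fun T : Submodule ℂ (Pair d) => (T : Set (Pair d))) (Submodule.span_eq S)
  rw [H10, Submodule.topologicalClosure_coe, this]

lemma IsTestPair.mem_H10 {U : Set (E d)} {p : Pair d} (hp : IsTestPair U p) : p ∈ H10 U := by
  have : p ∈ (H10 U : Set (Pair d)) := by rw [coe_H10]; exact subset_closure hp
  exact this

lemma isClosed_H10 (U : Set (E d)) : IsClosed (H10 U : Set (Pair d)) := by
  rw [coe_H10]; exact isClosed_closure

/-- A closed property of test pairs holds on `H^1_0`. -/
lemma H10_subset_of_isClosed {U : Set (E d)} {S : Set (Pair d)} (hS : IsClosed S)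
    (h : ∀ p, IsTestPair U p → p ∈ S) {p : Pair d} (hp : p ∈ H10 U) : p ∈ S := by
  have : p ∈ (H10 U : Set (Pair d)) := hp
  rw [coe_H10] at this
  exact closure_minimal h hS this

lemma IsTestPair.mono {U V : Set (E d)} (h : U ⊆ V) {p : Pair d} (hp : IsTestPair U p) :
    IsTestPair V p := by
  obtain ⟨φ, h1, h2, h3, h4⟩ := hp
  exact ⟨φ, h1, h2, h3.trans h, h4⟩

lemma H10_mono {U V : Set (E d)} (h : U ⊆ V) : H10 U ≤ H10 V := fun _ hp =>
  H10_subset_of_isClosed (isClosed_H10 V) (fun _ hq => (hq.mono h).mem_H10) hp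

/-- The gradient part of a pair at an index, as a continuous linear map. -/
def sndL (i : Fin d) : Pair d →L[ℂ] L2 d :=
  (PiLp.proj 2 (fun _ : Fin d => L2 d) i).comp (WithLp.sndL 2 ℂ (L2 d) (PiLp 2 fun _ : Fin d => L2 d))

@[simp] lemma sndL_apply (i : Fin d) (p : Pair d) : sndL i p = p.snd i := rfl

/-- The function part of a pair, as a continuous linear map. -/
def fstL : Pair d →L[ℂ] L2 d := WithLp.fstL 2 ℂ (L2 d) (PiLp 2 fun _ : Fin d => L2 d)

@[simp] lemma fstL_apply (p : Pair d) : fstL p = p.fst := rfl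

/-! ### Restriction to a subset -/

lemma memLp_indicator_one {A : Set (E d)} (hA : MeasurableSet A) :
    MemLp (A.indicator fun _ => (1 : ℂ)) ⊤ := (memLp_top_const (1 : ℂ)).indicator hA

/-- Restriction of a pair to a measurable set. -/
def cut (A : Set (E d)) (hA : MeasurableSet A) : Pair d →L[ℂ] Pair d :=
  ((WithLp.prodContinuousLinearEquiv 2 ℂ (L2 d) (PiLp 2 fun _ : Fin d => L2 d)).symm :
      (L2 d × PiLp 2 fun _ : Fin d => L2 d) →L[ℂ] Pair d).comp
    (((mulL _ (memLp_indicator_one hA)).comp fstL).prod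
      (((PiLp.continuousLinearEquiv 2 ℂ fun _ : Fin d => L2 d).symm :
        (Fin d → L2 d) →L[ℂ] PiLp 2 fun _ : Fin d => L2 d).comp
        (ContinuousLinearMap.pi fun i => (mulL _ (memLp_indicator_one hA)).comp (sndL i))))

lemma cut_fst_eq {A : Set (E d)} (hA : MeasurableSet A) (p : Pair d) :
    (cut A hA p).fst = mulL _ (memLp_indicator_one hA) p.fst := rfl

lemma cut_snd_eq {A : Set (E d)} (hA : MeasurableSet A) (p : Pair d) (i : Fin d) :
    (cut A hA p).snd i = mulL _ (memLp_indicator_one hA) (p.snd i) := rfl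

lemma coeFn_mulL_indicator {A : Set (E d)} (hA : MeasurableSet A) (f : L2 d) :
    mulL _ (memLp_indicator_one hA) f =ᵐ[volume] A.indicator f := by
  filter_upwards [coeFn_mulL _ (memLp_indicator_one hA) f] with x hx
  rw [hx]
  by_cases h : x ∈ A <;> simp [h]

lemma cut_fst {A : Set (E d)} (hA : MeasurableSet A) (p : Pair d) :
    ((cut A hA p).fst : E d → ℂ) =ᵐ[volume] A.indicator p.fst := coeFn_mulL_indicator hA _

lemma cut_snd {A : Set (E d)} (hA : MeasurableSet A) (p : Pair d) (i : Fin d) :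
    ((cut A hA p).snd i : E d → ℂ) =ᵐ[volume] A.indicator (p.snd i) := coeFn_mulL_indicator hA _

lemma inner_mulL_indicator {A : Set (E d)} (hA : MeasurableSet A) (f g : L2 d) :
    inner ℂ (mulL _ (memLp_indicator_one hA) f) g = inner ℂ f (mulL _ (memLp_indicator_one hA) g) := by
  rw [inner_L2_eq, inner_L2_eq]
  refine integral_congr_ae ?_
  filter_upwards [coeFn_mulL_indicator hA f, coeFn_mulL_indicator hA g] with x h1 h2
  rw [h1, h2]
  by_cases h : x ∈ A <;> simp [h]

/-- Multiplication by an indicator is self-adjoint and commutes with `W`. With `cut_cut_of_disjoint`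
this makes the parts of a function on disjoint sets orthogonal for every form of this type. -/
lemma form_cut {A : Set (E d)} (hA : MeasurableSet A) (W : E d → ℝ) (ψ χ : Pair d) :
    form W (cut A hA ψ) χ = form W ψ (cut A hA χ) := by
  rw [form, form]
  congr 1
  · refine Finset.sum_congr rfl fun i _ => ?_
    rw [← inner_L2_eq, ← inner_L2_eq, cut_snd_eq, cut_snd_eq, inner_mulL_indicator hA]
  · refine integral_congr_ae ?_
    filter_upwards [cut_fst hA ψ, cut_fst hA χ] with x h1 h2
    rw [h1, h2]
    by_cases h : x ∈ A <;> simp [h]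

lemma cut_cut_of_disjoint {A B : Set (E d)} (hA : MeasurableSet A) (hB : MeasurableSet B)
    (h : Disjoint A B) (p : Pair d) : cut A hA (cut B hB p) = 0 := by
  have key : ∀ f : L2 d, mulL _ (memLp_indicator_one hA) (mulL _ (memLp_indicator_one hB) f) = 0 := by
    intro f
    refine Lp.ext ?_
    filter_upwards [coeFn_mulL_indicator hA (mulL _ (memLp_indicator_one hB) f),
      coeFn_mulL_indicator hB f, Lp.coeFn_zero ℂ 2 (volume : Measure (E d))] with x h1 h2 h3
    rw [h1, h3]
    by_cases hx : x ∈ A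
    · rw [Set.indicator_of_mem hx, h2, Set.indicator_of_notMem (fun hb => h.le_bot ⟨hx, hb⟩)]; rfl
    · rw [Set.indicator_of_notMem hx]; rfl
  exact (WithLp.ofLp_injective 2) (Prod.ext (key _) (PiLp.ext fun i => key _))

/-- A test pair cut to one of two disjoint open sets. -/
lemma IsTestPair.cut {U A B : Set (E d)} (hA : IsOpen A) (hB : IsOpen B) (hAB : Disjoint A B)
    (hU : U ⊆ A ∪ B) {p : Pair d} (hp : IsTestPair U p) :
    IsTestPair A (cut A hA.measurableSet p) := by
  obtain ⟨φ, h1, h2, h3, h4, h5⟩ := hp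
  -- Compactness is what keeps the cut function smooth up to the boundary of `A`: on the support of
  -- `φ`, being in `A` is the same as avoiding the open set `B`, a closed condition.
  have hK : IsCompact (tsupport φ ∩ A) := by
    have : tsupport φ ∩ A = tsupport φ \ B := by
      ext x
      constructor
      · exact fun hx => ⟨hx.1, fun hb => hAB.le_bot ⟨hx.2, hb⟩⟩
      · exact fun hx => ⟨hx.1, (hU (h3 hx.1)).resolve_right hx.2⟩
    rw [this]
    exact h2.isCompact.diff hB
  have hs : Function.support (A.indicator φ) ⊆ tsupport φ ∩ A := by
    intro x hx
    rw [Function.mem_support] at hx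
    by_cases hxA : x ∈ A
    · rw [Set.indicator_of_mem hxA] at hx
      exact ⟨subset_tsupport _ hx, hxA⟩
    · exact absurd (Set.indicator_of_notMem hxA φ) hx
  have hts : tsupport (A.indicator φ) ⊆ tsupport φ ∩ A := closure_minimal hs hK.isClosed
  have heq : ∀ x ∈ A, A.indicator φ =ᶠ[𝓝 x] φ := fun x hx => by
    filter_upwards [hA.mem_nhds hx] with y hy using Set.indicator_of_mem hy φ
  have hz : ∀ x, x ∉ A → A.indicator φ =ᶠ[𝓝 x] 0 := fun x hx => by
    rw [← notMem_tsupport_iff_eventuallyEq]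
    exact fun h => hx (hts h).2
  refine ⟨A.indicator φ, ?_, HasCompactSupport.of_support_subset_isCompact hK hs,
    hts.trans Set.inter_subset_right, ?_, fun i => ?_⟩
  · rw [contDiff_iff_contDiffAt]
    intro x
    by_cases hx : x ∈ A
    · exact h1.contDiffAt.congr_of_eventuallyEq (heq x hx)
    · exact (contDiffAt_const (c := (0 : ℂ))).congr_of_eventuallyEq (hz x hx)
  · filter_upwards [h4, cut_fst hA.measurableSet p] with x e1 e2
    rw [e2]
    by_cases hx : x ∈ A <;> simp [hx, e1]
  · filter_upwards [h5 i, cut_snd hA.measurableSet p i] with x e1 e2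
    rw [e2]
    by_cases hx : x ∈ A
    · rw [Set.indicator_of_mem hx, e1, (heq x hx).fderiv_eq]
    · rw [Set.indicator_of_notMem hx, (hz x hx).fderiv_eq]
      simp

lemma cut_mem_H10 {U A B : Set (E d)} (hA : IsOpen A) (hB : IsOpen B) (hAB : Disjoint A B)
    (hU : U ⊆ A ∪ B) {p : Pair d} (hp : p ∈ H10 U) : cut A hA.measurableSet p ∈ H10 A :=
  H10_subset_of_isClosed (S := {p | cut A hA.measurableSet p ∈ H10 A})
    ((isClosed_H10 A).preimage (cut A hA.measurableSet).continuous)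
    (fun _ hq => (hq.cut hA hB hAB hU).mem_H10) hp

lemma cut_eq_self {A V : Set (E d)} (hA : MeasurableSet A) (hV : V ⊆ A) {p : Pair d}
    (hp : p ∈ H10 V) : cut A hA p = p := by
  refine H10_subset_of_isClosed (S := {p | cut A hA p = p})
    (isClosed_eq (cut A hA).continuous continuous_id) (fun q hq => ?_) hp
  obtain ⟨φ, h1, h2, h3, h4, h5⟩ := hq
  refine Pair.ext_ae ?_ fun i => ?_
  · filter_upwards [h4, cut_fst hA q] with x e1 e2
    rw [e2]
    by_cases hx : x ∈ A
    · simp [hx]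
    · rw [Set.indicator_of_notMem hx, e1]
      exact (image_eq_zero_of_notMem_tsupport fun h => hx (hV (h3 h))).symm
  · filter_upwards [h5 i, cut_snd hA q i] with x e1 e2
    rw [e2]
    by_cases hx : x ∈ A
    · simp [hx]
    · rw [Set.indicator_of_notMem hx, e1]
      have : fderiv ℝ φ x = 0 :=
        image_eq_zero_of_notMem_tsupport fun h => hx (hV (h3 (tsupport_fderiv_subset ℝ h)))
      simp [this]

lemma cut_add_cut {U A B : Set (E d)} (hA : IsOpen A) (hB : IsOpen B) (hAB : Disjoint A B)
    (hU : U ⊆ A ∪ B) {p : Pair d} (hp : p ∈ H10 U) :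
    cut A hA.measurableSet p + cut B hB.measurableSet p = p := by
  have h := cut_eq_self (hA.union hB).measurableSet hU hp
  have key : ∀ f : L2 d, mulL _ (memLp_indicator_one hA.measurableSet) f
      + mulL _ (memLp_indicator_one hB.measurableSet) f
      = mulL _ (memLp_indicator_one (hA.union hB).measurableSet) f := by
    intro f
    refine Lp.ext ?_
    filter_upwards [coeFn_mulL_indicator hA.measurableSet f,
      coeFn_mulL_indicator hB.measurableSet f, coeFn_mulL_indicator (hA.union hB).measurableSet f,
      Lp.coeFn_add (mulL _ (memLp_indicator_one hA.measurableSet) f)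
        (mulL _ (memLp_indicator_one hB.measurableSet) f)] with x e1 e2 e3 e4
    rw [e4, Pi.add_apply, e1, e2, e3, Set.indicator_union_of_disjoint hAB]
  conv_rhs => rw [← h]
  exact (WithLp.ofLp_injective 2) (Prod.ext (key _) (PiLp.ext fun i => key _))

/-- Elements of `H^1_0(V)` vanish outside `V`. -/
lemma fst_eq_zero_of_notMem {V : Set (E d)} (hV : MeasurableSet V) {p : Pair d} (hp : p ∈ H10 V) :
    ∀ᵐ x, x ∉ V → p.fst x = 0 := by
  have h := cut_fst hV p
  rw [cut_eq_self hV subset_rfl hp] at h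
  filter_upwards [h] with x hx hxV
  rw [hx, Set.indicator_of_notMem hxV]

/-! ### A Fourier inequality on `H^1_0` of a bounded set -/

open scoped LineDeriv in
lemma norm_fourier_lineDeriv (f : SchwartzMap (E d) ℂ) (i : Fin d) (ξ : E d) :
    ‖𝓕 (∂_{EuclideanSpace.single i (1 : ℝ)} f) ξ‖ ^ 2
      = 4 * Real.pi ^ 2 * ξ i ^ 2 * ‖𝓕 f ξ‖ ^ 2 := by
  have : (inner ℝ · (EuclideanSpace.single i (1 : ℝ)) : E d → ℝ).HasTemperateGrowth :=
    ((innerSL ℝ).flip (EuclideanSpace.single i (1 : ℝ))).hasTemperateGrowth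
  rw [SchwartzMap.fourier_lineDerivOp_eq]
  rw [smul_apply, SchwartzMap.smulLeftCLM_apply_apply this, norm_smul, norm_smul]
  simp only [EuclideanSpace.inner_single_right, norm_mul, Complex.norm_real, Complex.norm_I,
    Real.norm_eq_abs, mul_pow, sq_abs, Complex.norm_ofNat]
  simp
  ring

/-- The tangent line of the exponential at the origin, shifted by 2. The value 3 leaves one unit of
mass over when the gradient term later absorbs two. -/
lemma three_sub_le_exp (x : ℝ) : 3 - x ≤ Real.exp 2 * Real.exp (-x) := by
  rw [← Real.exp_add]
  have := Real.add_one_le_exp (2 + -x)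
  linarith

/-- The pointwise bound `3 - x ≤ e^(2-x)` integrated against `|φ̂|²`. -/
lemma three_mul_integral_le (f : SchwartzMap (E d) ℂ) {t : ℝ} (ht : 0 < t) :
    3 * ∫ x, ‖f x‖ ^ 2 ≤
      2 * t * (∑ i, ∫ x, ‖fderiv ℝ f x (EuclideanSpace.single i (1 : ℝ))‖ ^ 2)
      + Real.exp 2 * ∫ ξ, ‖𝓕 (f : E d → ℂ) ξ‖ ^ 2 * Real.exp (-(8 * Real.pi ^ 2 * t) * ‖ξ‖ ^ 2) := by
  open scoped LineDeriv in
  have hint : ∀ g : SchwartzMap (E d) ℂ, Integrable fun x => ‖g x‖ ^ 2 := fun g =>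
    (memLp_two_iff_integrable_sq_norm g.continuous.aestronglyMeasurable).1 (g.memLp 2 volume)
  have e1 : ∀ i, ∫ x, ‖fderiv ℝ f x (EuclideanSpace.single i (1 : ℝ))‖ ^ 2
      = ∫ ξ, 4 * Real.pi ^ 2 * ξ i ^ 2 * ‖𝓕 f ξ‖ ^ 2 := fun i => by
    simp only [← norm_fourier_lineDeriv]
    rw [SchwartzMap.integral_norm_sq_fourier]
    rfl
  have i1 : ∀ i, Integrable fun ξ : E d => 4 * Real.pi ^ 2 * ξ i ^ 2 * ‖𝓕 f ξ‖ ^ 2 := fun i => by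
    simp only [← norm_fourier_lineDeriv]
    exact hint _
  have i2 : Integrable fun ξ : E d =>
      ‖𝓕 f ξ‖ ^ 2 * Real.exp (-(8 * Real.pi ^ 2 * t) * ‖ξ‖ ^ 2) := by
    refine (hint (𝓕 f)).mono' (by fun_prop) (ae_of_all _ fun ξ => ?_)
    rw [Real.norm_eq_abs, abs_of_nonneg (by positivity)]
    refine mul_le_of_le_one_right (by positivity) (Real.exp_le_one_iff.2 ?_)
    have : 0 ≤ 8 * Real.pi ^ 2 * t * ‖ξ‖ ^ 2 := by positivity
    linarith
  rw [← SchwartzMap.integral_norm_sq_fourier, Finset.sum_congr rfl fun i _ => e1 i,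
    ← integral_finsetSum _ fun i _ => i1 i, ← SchwartzMap.fourier_coe, ← integral_const_mul,
    ← integral_const_mul, ← integral_const_mul, ← integral_add
      ((integrable_finsetSum _ fun i _ => i1 i).const_mul _) (i2.const_mul _)]
  refine integral_mono ((hint _).const_mul _)
    (((integrable_finsetSum _ fun i _ => i1 i).const_mul _).add (i2.const_mul _)) fun ξ => ?_
  have h := three_sub_le_exp (8 * Real.pi ^ 2 * t * ‖ξ‖ ^ 2)
  have hs : ∑ i, 4 * Real.pi ^ 2 * ξ i ^ 2 * ‖𝓕 f ξ‖ ^ 2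
      = 4 * Real.pi ^ 2 * ‖ξ‖ ^ 2 * ‖𝓕 f ξ‖ ^ 2 := by
    rw [EuclideanSpace.norm_sq_eq, Finset.mul_sum, Finset.sum_mul]
    simp
  simp only [hs]
  have h' := mul_le_mul_of_nonneg_right h (sq_nonneg ‖𝓕 f ξ‖)
  rw [← neg_mul] at h'
  linarith

/-! ### Fourier transforms on sets of finite measure and the Gaussian mass -/

/-- The character `x ↦ e^(2πi⟨x,ξ⟩)` restricted to `U`. -/
def charOn (U : Set (E d)) (ξ : E d) : E d → ℂ :=
  U.indicator fun x => Complex.exp ((2 * Real.pi * inner ℝ x ξ : ℝ) * Complex.I)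

lemma norm_charOn_le (U : Set (E d)) (ξ x : E d) : ‖charOn U ξ x‖ ≤ U.indicator (fun _ => (1 : ℝ)) x := by
  rw [charOn]
  by_cases h : x ∈ U
  · rw [Set.indicator_of_mem h, Set.indicator_of_mem h, Complex.norm_exp_ofReal_mul_I]
  · rw [Set.indicator_of_notMem h, Set.indicator_of_notMem h, norm_zero]

lemma memLp_charOn {U : Set (E d)} (hU : MeasurableSet U) (hf : volume U ≠ ⊤) (ξ : E d) :
    MemLp (charOn U ξ) 2 := by
  refine MemLp.mono (memLp_indicator_const 2 hU (1 : ℝ) (Or.inr hf)) ?_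
    (ae_of_all _ fun x => (norm_charOn_le U ξ x).trans (le_abs_self _))
  exact (Continuous.aestronglyMeasurable (by fun_prop)).indicator hU

lemma norm_toLp_charOn_le {U : Set (E d)} (hU : MeasurableSet U) (hf : volume U ≠ ⊤) (ξ : E d) :
    ‖(memLp_charOn hU hf ξ).toLp‖ ≤ ‖indicatorConstLp 2 hU hf (1 : ℝ)‖ := by
  refine Lp.norm_le_norm_of_ae_le ?_
  filter_upwards [(memLp_charOn hU hf ξ).coeFn_toLp, indicatorConstLp_coeFn (p := 2) (hs := hU)
    (hμs := hf) (c := (1 : ℝ))] with x h1 h2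
  rw [h1, h2]
  exact (norm_charOn_le U ξ x).trans (le_abs_self _)

/-- When `U` has finite measure the character restricted to `U` lies in `L^2`, so each value of the
transform is a weakly continuous functional of `f`. -/
lemma fourier_indicator_eq {U : Set (E d)} (hU : MeasurableSet U) (hf : volume U ≠ ⊤) (f : L2 d)
    (ξ : E d) : 𝓕 (U.indicator f) ξ = inner ℂ ((memLp_charOn hU hf ξ).toLp) f := by
  rw [inner_L2_eq, Real.fourier_eq']
  refine integral_congr_ae ?_
  filter_upwards [(memLp_charOn hU hf ξ).coeFn_toLp] with x hx
  rw [hx, charOn]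
  by_cases h : x ∈ U
  · rw [Set.indicator_of_mem h, Set.indicator_of_mem h, ← Complex.exp_conj, map_mul,
      Complex.conj_ofReal, Complex.conj_I, smul_eq_mul]
    congr 2
    push_cast
    ring
  · simp [h]

lemma integrable_indicator_L2 {U : Set (E d)} (hU : MeasurableSet U) (hf : volume U ≠ ⊤)
    (f : L2 d) : Integrable (U.indicator f) := by
  rw [integrable_indicator_iff hU]
  have : IsFiniteMeasure (volume.restrict U) := ⟨by simpa using hf.lt_top⟩
  exact ((Lp.memLp f).restrict U).integrable (by norm_num)

lemma continuous_fourier_indicator {U : Set (E d)} (hU : MeasurableSet U) (hf : volume U ≠ ⊤)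
    (f : L2 d) : Continuous (𝓕 (U.indicator f)) :=
  VectorFourier.fourierIntegral_continuous Real.continuous_fourierChar
    (by exact continuous_inner) (integrable_indicator_L2 hU hf f)

/-- `∫ |f̂|² e^(-b|ξ|²)` for the part of `f` in `U`. -/
def gaussMass (U : Set (E d)) (b : ℝ) (f : L2 d) : ℝ :=
  ∫ ξ, ‖𝓕 (U.indicator f) ξ‖ ^ 2 * Real.exp (-b * ‖ξ‖ ^ 2)

lemma integrable_gauss {b : ℝ} (hb : 0 < b) : Integrable fun ξ : E d => Real.exp (-b * ‖ξ‖ ^ 2) := by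
  have h := (GaussianFourier.integrable_cexp_neg_mul_sq_norm_add (V := E d) (b := (b : ℂ))
    (by simpa using hb) 0 0).norm
  refine h.congr (ae_of_all _ fun ξ => ?_)
  simp only [Complex.norm_exp]
  congr 1
  have : (-(b : ℂ) * (‖ξ‖ : ℂ) ^ 2 + 0 * ((inner ℝ (0 : E d) ξ : ℝ) : ℂ)) =
    ((-b * ‖ξ‖ ^ 2 : ℝ) : ℂ) := by push_cast; ring
  rw [this, Complex.ofReal_re]

/-- Weakly convergent sequences have convergent Gaussian masses. -/
lemma tendsto_gaussMass {U : Set (E d)} (hU : MeasurableSet U) (hf : volume U ≠ ⊤) {b : ℝ}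
    (hb : 0 < b) {f : ℕ → L2 d} {g : L2 d} {M : ℝ} (hM : ∀ n, ‖f n‖ ≤ M)
    (h : ∀ k : L2 d, Tendsto (fun n => inner ℂ k (f n)) atTop (𝓝 (inner ℂ k g))) :
    Tendsto (fun n => gaussMass U b (f n)) atTop (𝓝 (gaussMass U b g)) := by
  refine tendsto_integral_of_dominated_convergence
    (fun ξ => (‖indicatorConstLp 2 hU hf (1 : ℝ)‖ * M) ^ 2 * Real.exp (-b * ‖ξ‖ ^ 2))
    (fun n => ?_) ((integrable_gauss hb).const_mul _) (fun n => ae_of_all _ fun ξ => ?_)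
    (ae_of_all _ fun ξ => ?_)
  · exact (((continuous_fourier_indicator hU hf _).norm.pow 2).mul
      (by fun_prop)).aestronglyMeasurable
  · rw [Real.norm_eq_abs, abs_of_nonneg (by positivity)]
    gcongr
    rw [fourier_indicator_eq hU hf]
    refine (norm_inner_le_norm _ _).trans ?_
    exact mul_le_mul (norm_toLp_charOn_le hU hf ξ) (hM n) (norm_nonneg _) (norm_nonneg _)
  · refine Tendsto.mul_const _ (Tendsto.pow (Tendsto.norm ?_) 2)
    simp only [fourier_indicator_eq hU hf]
    exact h _

lemma continuous_gaussMass {U : Set (E d)} (hU : MeasurableSet U) (hf : volume U ≠ ⊤) {b : ℝ}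
    (hb : 0 < b) : Continuous (gaussMass U b) := by
  refine continuous_iff_seqContinuous.2 fun f g h => ?_
  obtain ⟨M, hM⟩ := (Metric.isBounded_range_of_tendsto f h).exists_norm_le
  exact tendsto_gaussMass hU hf hb (fun n => hM _ ⟨n, rfl⟩) fun k => tendsto_const_nhds.inner h

/-- Both sides are continuous in the pair, so the inequality passes from test functions to their
closure. The Gaussian term is the squared `L^2` norm of `e^(tΔ) f`: large frequencies are paid for
by the gradient, small ones by a smoothed quantity. -/
lemma three_mul_norm_sq_le {U : Set (E d)} (hU : MeasurableSet U) (hf : volume U ≠ ⊤) {t : ℝ}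
    (ht : 0 < t) {p : Pair d} (hp : p ∈ H10 U) :
    3 * ‖p.fst‖ ^ 2 ≤ 2 * t * ‖p.snd‖ ^ 2
      + Real.exp 2 * gaussMass U (8 * Real.pi ^ 2 * t) p.fst := by
  have hb : 0 < 8 * Real.pi ^ 2 * t := by positivity
  have c1 : Continuous fun p : Pair d => p.fst := WithLp.continuous_fst 2 _ _
  have c2 : Continuous fun p : Pair d => p.snd := WithLp.continuous_snd 2 _ _
  refine H10_subset_of_isClosed (S := {p : Pair d | 3 * ‖p.fst‖ ^ 2 ≤ 2 * t * ‖p.snd‖ ^ 2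
      + Real.exp 2 * gaussMass U (8 * Real.pi ^ 2 * t) p.fst})
    (isClosed_le (by fun_prop) (((continuous_const.mul (c2.norm.pow 2))).add
      (continuous_const.mul ((continuous_gaussMass hU hf hb).comp c1)))) (fun q hq => ?_) hp
  obtain ⟨φ, h1, h2, h3, h4, h5⟩ := hq
  have h := three_mul_integral_le (h2.toSchwartzMap h1) ht
  have hφ : ((h2.toSchwartzMap h1 : SchwartzMap (E d) ℂ) : E d → ℂ) = φ := rfl
  rw [hφ] at h
  have a1 : ∫ x, ‖φ x‖ ^ 2 = ‖q.fst‖ ^ 2 := by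
    rw [← integral_norm_sq_L2]
    refine integral_congr_ae ?_
    filter_upwards [h4] with x hx
    rw [hx]
  have a2 : ∑ i, ∫ x, ‖fderiv ℝ φ x (EuclideanSpace.single i (1 : ℝ))‖ ^ 2 = ‖q.snd‖ ^ 2 := by
    rw [← sum_integral_snd]
    refine Finset.sum_congr rfl fun i _ => integral_congr_ae ?_
    filter_upwards [h5 i] with x hx
    rw [hx]
  have a3 : 𝓕 (U.indicator q.fst) = 𝓕 φ := by
    have : (U.indicator q.fst : E d → ℂ) =ᵐ[volume] φ := by
      filter_upwards [h4] with x hx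
      by_cases hxU : x ∈ U
      · rw [Set.indicator_of_mem hxU, hx]
      · rw [Set.indicator_of_notMem hxU]
        exact (image_eq_zero_of_notMem_tsupport fun h => hxU (h3 h)).symm
    ext ξ
    rw [Real.fourier_eq, Real.fourier_eq]
    refine integral_congr_ae ?_
    filter_upwards [this] with x hx
    rw [hx]
  rw [Set.mem_ofPred_eq, gaussMass, a3, ← a1, ← a2]
  exact h

/-- A bound on the Gaussian mass in terms of the `L^1` norm. -/
lemma gaussMass_le {U : Set (E d)} {b : ℝ} (hb : 0 < b)
    {f : L2 d} {m : ℝ} (hm : ∫ x, ‖U.indicator f x‖ ≤ m) :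
    gaussMass U b f ≤ m ^ 2 * (Real.pi / b) ^ ((d : ℝ) / 2) := by
  have h := GaussianFourier.integral_rexp_neg_mul_sq_norm (V := E d) hb
  rw [finrank_euclideanSpace_fin] at h
  rw [← h, ← integral_const_mul, gaussMass]
  have hle : ∀ ξ, ‖𝓕 (U.indicator f) ξ‖ ≤ m := fun ξ =>
    (VectorFourier.norm_fourierIntegral_le_integral_norm _ _ _ _ _).trans hm
  refine integral_mono_of_nonneg (ae_of_all _ fun ξ => by positivity)
    ((integrable_gauss hb).const_mul _) (ae_of_all _ fun ξ => ?_)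
  have := hle ξ
  dsimp only
  gcongr

/-- Integrates `|f| ≤ 1 + |f|²` over `U`; only some finite bound on the `L^1` norm is needed. -/
lemma integral_norm_indicator_le {U : Set (E d)} (hU : MeasurableSet U) (hf : volume U ≠ ⊤)
    (f : L2 d) : ∫ x, ‖U.indicator f x‖ ≤ volume.real U + ‖f‖ ^ 2 := by
  rw [← integral_norm_sq_L2]
  have h1 : Integrable (U.indicator fun _ => (1 : ℝ)) :=
    (integrable_indicator_iff hU).2 (integrableOn_const hf)
  have : volume.real U = ∫ x, U.indicator (fun _ => (1 : ℝ)) x := by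
    rw [integral_indicator hU]; simp
  rw [this, ← integral_add h1 (integrable_norm_sq_L2 f)]
  refine integral_mono (integrable_indicator_L2 hU hf f).norm (h1.add (integrable_norm_sq_L2 f))
    fun x => ?_
  by_cases h : x ∈ U
  · simp only [Set.indicator_of_mem h]
    nlinarith [sq_nonneg (‖f x‖ - 1), norm_nonneg (f x)]
  · simp [h]

/-! ### Compactness and the direct method -/

/-- Bounded sequences in a separable Hilbert space have weakly convergent subsequences. -/
lemma exists_weak_subseq {H : Type*} [NormedAddCommGroup H] [InnerProductSpace ℂ H]
    [CompleteSpace H] [TopologicalSpace.SeparableSpace H] {x : ℕ → H} {M : ℝ}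
    (hM : ∀ n, ‖x n‖ ≤ M) :
    ∃ (p : H) (s : ℕ → ℕ), StrictMono s ∧
      ∀ k, Tendsto (fun n => inner ℂ k (x (s n))) atTop (𝓝 (inner ℂ k p)) := by
  -- By the Riesz representation the sequence lives in the dual, where separability makes the closed
  -- ball weak-* sequentially compact.
  let u : ℕ → WeakDual ℂ H := fun n =>
    StrongDual.toWeakDual (InnerProductSpace.toDual ℂ H (x n))
  have hu : ∀ n, u n ∈ WeakDual.toStrongDual ⁻¹' Metric.closedBall (0 : StrongDual ℂ H) M := by
    intro n
    change InnerProductSpace.toDual ℂ H (x n) ∈ Metric.closedBall (0 : StrongDual ℂ H) M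
    simpa using hM n
  obtain ⟨f, -, s, hs, hf⟩ := WeakDual.isSeqCompact_closedBall ℂ H 0 M hu
  refine ⟨(InnerProductSpace.toDual ℂ H).symm (WeakDual.toStrongDual f), s, hs, fun k => ?_⟩
  have h1 : Tendsto (fun n => (u (s n)) k) atTop (𝓝 (f k)) :=
    ((WeakDual.eval_continuous k).tendsto f).comp hf
  have h2 : ∀ n, (u (s n)) k = inner ℂ (x (s n)) k := fun n =>
    InnerProductSpace.toDual_apply_apply
  have h3 : f k = inner ℂ ((InnerProductSpace.toDual ℂ H).symm (WeakDual.toStrongDual f)) k := by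
    rw [InnerProductSpace.toDual_symm_apply]; rfl
  simp only [h2] at h1
  rw [h3] at h1
  have := (Complex.continuous_conj.tendsto _).comp h1
  simpa only [Function.comp_def, inner_conj_symm] using this

instance separableSpace_pair : TopologicalSpace.SeparableSpace (Pair d) :=
  have : Fact ((2 : ENNReal) ≠ ⊤) := ⟨by norm_num⟩
  have : SecondCountableTopology (Pair d) := WithLp.secondCountableTopology 2 _ _
  inferInstance

/-- A closed subspace is its own double orthogonal complement, and orthogonality to a fixed vector
survives weak limits. -/
lemma mem_H10_of_weak {U : Set (E d)} {p : ℕ → Pair d} {q : Pair d} (hp : ∀ n, p n ∈ H10 U)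
    (h : ∀ k, Tendsto (fun n => inner ℂ k (p n)) atTop (𝓝 (inner ℂ k q))) : q ∈ H10 U := by
  have : CompleteSpace (H10 U) := (isClosed_H10 U).completeSpace_coe
  rw [← Submodule.orthogonal_orthogonal (H10 U), Submodule.mem_orthogonal]
  intro k hk
  have h0 : ∀ n, inner ℂ k (p n) = 0 := fun n => Submodule.inner_left_of_mem_orthogonal (hp n) hk
  have := h k
  simp only [h0] at this
  exact tendsto_nhds_unique this tendsto_const_nhds

lemma tendsto_inner_fst {p : ℕ → Pair d} {q : Pair d}
    (h : ∀ k, Tendsto (fun n => inner ℂ k (p n)) atTop (𝓝 (inner ℂ k q))) (k : L2 d) :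
    Tendsto (fun n => inner ℂ k (p n).fst) atTop (𝓝 (inner ℂ k q.fst)) := by
  have := h (WithLp.toLp 2 (k, 0))
  simpa [WithLp.prod_inner_apply] using this

lemma tendsto_inner_snd {p : ℕ → Pair d} {q : Pair d}
    (h : ∀ k, Tendsto (fun n => inner ℂ k (p n)) atTop (𝓝 (inner ℂ k q)))
    (k : PiLp 2 fun _ : Fin d => L2 d) :
    Tendsto (fun n => inner ℂ k (p n).snd) atTop (𝓝 (inner ℂ k q.snd)) := by
  have := h (WithLp.toLp 2 (0, k))
  simpa only [WithLp.prod_inner_apply, WithLp.ofLp_fst, WithLp.ofLp_snd, WithLp.toLp_fst,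
    WithLp.toLp_snd, inner_zero_left, zero_add] using this

/-- Rellich's theorem: weak convergence in `H^1_0(U)` implies convergence in `L^2`. -/
lemma tendsto_fst_of_weak {U : Set (E d)} (hU : MeasurableSet U) (hf : volume U ≠ ⊤)
    {p : ℕ → Pair d} {q : Pair d} {M : ℝ} (hp : ∀ n, p n ∈ H10 U) (hM : ∀ n, ‖p n‖ ≤ M)
    (h : ∀ k, Tendsto (fun n => inner ℂ k (p n)) atTop (𝓝 (inner ℂ k q))) :
    Tendsto (fun n => (p n).fst) atTop (𝓝 q.fst) := by
  have hq : q ∈ H10 U := mem_H10_of_weak hp h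
  set K := M + ‖q‖ + 1 with hK
  have hM0 : 0 ≤ M := (norm_nonneg _).trans (hM 0)
  have hKpos : 0 < K := by positivity
  have hb : ∀ n, ‖p n - q‖ ≤ K := fun n => (norm_sub_le _ _).trans (by linarith [hM n])
  have hw : ∀ k : L2 d, Tendsto (fun n => inner ℂ k (p n - q).fst) atTop (𝓝 (inner ℂ k 0)) := by
    intro k
    have := (tendsto_inner_fst h k).sub_const (inner ℂ k q.fst)
    simpa [WithLp.sub_fst, inner_sub_right] using this
  rw [tendsto_iff_norm_sub_tendsto_zero]
  rw [Metric.tendsto_atTop]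
  intro ε hε
  -- With this `t` the gradient term is at most `ε²`. Once the Gaussian term is also below `ε²`,
  -- three times the squared norm is below `2ε²`.
  set t := ε ^ 2 / (2 * K ^ 2) with ht
  have htpos : 0 < t := by positivity
  have hg := tendsto_gaussMass hU hf (b := 8 * Real.pi ^ 2 * t) (by positivity)
    (fun n => (WithLp.norm_fst_le _ (p n - q)).trans (hb n)) hw
  have hg0 : gaussMass U (8 * Real.pi ^ 2 * t) (0 : L2 d) = 0 := by
    have h0 : ∀ ξ, 𝓕 (U.indicator (0 : L2 d)) ξ = 0 := fun ξ => by
      rw [fourier_indicator_eq hU hf, inner_zero_right]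
    simp only [gaussMass, h0]
    simp
  rw [hg0, Metric.tendsto_atTop] at hg
  obtain ⟨n0, hn0⟩ := hg (ε ^ 2 / Real.exp 2) (by positivity)
  refine ⟨n0, fun n hn => ?_⟩
  have h1 := three_mul_norm_sq_le hU hf htpos ((H10 U).sub_mem (hp n) hq)
  have h2 : Real.exp 2 * gaussMass U (8 * Real.pi ^ 2 * t) (p n - q).fst < ε ^ 2 := by
    have := (abs_lt.1 (by simpa [Real.dist_eq] using hn0 n hn)).2
    rwa [lt_div_iff₀' (Real.exp_pos 2)] at this
  have h3 : 2 * t * ‖(p n - q).snd‖ ^ 2 ≤ ε ^ 2 := by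
    have : ‖(p n - q).snd‖ ≤ K := (WithLp.norm_snd_le _ _).trans (hb n)
    calc 2 * t * ‖(p n - q).snd‖ ^ 2 ≤ 2 * t * K ^ 2 := by gcongr
      _ = ε ^ 2 := by rw [ht]; field_simp
  rw [Real.dist_eq, sub_zero, abs_norm, ← WithLp.sub_fst]
  refine lt_of_pow_lt_pow_left₀ 2 hε.le ?_
  nlinarith [sq_nonneg ε, pow_pos hε 2]

/-- The direct method for functionals `‖∇ψ‖^2 + J(ψ)` on the unit sphere. -/
theorem exists_minimizer {U : Set (E d)} (hU : MeasurableSet U) (hf : volume U ≠ ⊤)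
    {J : L2 d → ℝ} (hJ : Continuous J) {B : ℝ} (hB : ∀ f, ‖f‖ = 1 → B ≤ J f)
    (hne : ∃ p ∈ H10 U, ‖p.fst‖ = 1) :
    ∃ p ∈ H10 U, ‖p.fst‖ = 1 ∧
      ∀ q ∈ H10 U, ‖q.fst‖ = 1 → ‖p.snd‖ ^ 2 + J p.fst ≤ ‖q.snd‖ ^ 2 + J q.fst := by
  set S : Set ℝ := {e | ∃ p ∈ H10 U, ‖p.fst‖ = 1 ∧ e = ‖p.snd‖ ^ 2 + J p.fst} with hS
  have hSne : S.Nonempty := by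
    obtain ⟨p, h1, h2⟩ := hne
    exact ⟨_, p, h1, h2, rfl⟩
  have hSb : BddBelow S := by
    refine ⟨B, ?_⟩
    rintro _ ⟨p, -, h2, rfl⟩
    have := hB _ h2
    linarith [sq_nonneg ‖p.snd‖]
  obtain ⟨e, -, he, heS⟩ := exists_seq_tendsto_sInf hSne hSb
  choose p hp1 hp2 hp3 using heS
  obtain ⟨M, hM⟩ := (Metric.isBounded_range_of_tendsto e he).exists_norm_le
  -- The energies are bounded by `M` and `J` is at least `B`, so `‖p n‖² ≤ 1 + (M - B)`; the bound
  -- on the norm is a crude one that avoids a square root.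
  have hbd : ∀ n, ‖p n‖ ≤ 1 + (M - B) + 1 := by
    intro n
    have h1 := (le_abs_self _).trans (hM _ ⟨n, rfl⟩)
    have h2 := hB _ (hp2 n)
    have h3 := WithLp.prod_norm_sq_eq_of_L2 (p n)
    rw [hp2 n] at h3
    have h4 : ‖p n‖ ^ 2 ≤ 1 + (M - B) := by rw [h3]; linarith [hp3 n]
    nlinarith [sq_nonneg (‖p n‖ - 1)]
  obtain ⟨q, s, hs, hw⟩ := exists_weak_subseq hbd
  have hq : q ∈ H10 U := mem_H10_of_weak (fun n => hp1 (s n)) hw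
  have hst := tendsto_fst_of_weak hU hf (fun n => hp1 (s n)) (fun n => hbd (s n)) hw
  have hq1 : ‖q.fst‖ = 1 := by
    refine tendsto_nhds_unique hst.norm ?_
    simp only [hp2]
    exact tendsto_const_nhds
  refine ⟨q, hq, hq1, fun r hr hr1 => ?_⟩
  have hle : ‖q.snd‖ ^ 2 + J q.fst ≤ sInf S := by
    -- Weak lower semicontinuity of the gradient norm by linearization: `2 Re⟨q, p⟩ - ‖q‖² ≤ ‖p‖²`,
    -- where the left side is weakly continuous in `p`.
    have h1 : Tendsto (fun n => 2 * (inner ℂ q.snd (p (s n)).snd : ℂ).re - ‖q.snd‖ ^ 2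
        + J (p (s n)).fst) atTop
        (𝓝 (2 * (inner ℂ q.snd q.snd : ℂ).re - ‖q.snd‖ ^ 2 + J q.fst)) :=
      ((((Complex.continuous_re.tendsto _).comp (tendsto_inner_snd hw q.snd)).const_mul 2).sub_const
        _).add ((hJ.tendsto _).comp hst)
    have h2 : (inner ℂ q.snd q.snd : ℂ).re = ‖q.snd‖ ^ 2 := by
      rw [inner_self_eq_norm_sq_to_K]
      norm_cast
    rw [h2] at h1
    have h3 := le_of_tendsto_of_tendsto h1 (he.comp hs.tendsto_atTop) (Eventually.of_forall fun n => by
      have h4 := norm_sub_sq (𝕜 := ℂ) (p (s n)).snd q.snd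
      rw [← inner_conj_symm, RCLike.conj_re] at h4
      have h5 := sq_nonneg ‖(p (s n)).snd - q.snd‖
      simp only [Function.comp_apply, hp3]
      have h6 : RCLike.re (inner ℂ q.snd (p (s n)).snd : ℂ)
        = (inner ℂ q.snd (p (s n)).snd : ℂ).re := rfl
      rw [h6] at h4
      linarith)
    linarith
  exact hle.trans (csInf_le hSb ⟨r, hr, hr1, rfl⟩)

/-! ### Lowest eigenvalues of Schrödinger operators -/

lemma form_add_right {W : E d → ℝ} (hW : MemLp W ⊤) (p q r : Pair d) :
    form W p (q + r) = form W p q + form W p r := by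
  simp only [form_eq hW, WithLp.add_fst, WithLp.add_snd, map_add, inner_add_right]
  ring

lemma form_add_left {W : E d → ℝ} (hW : MemLp W ⊤) (p q r : Pair d) :
    form W (p + q) r = form W p r + form W q r := by
  simp only [form_eq hW, WithLp.add_fst, WithLp.add_snd, inner_add_left]
  ring

lemma form_smul_right {W : E d → ℝ} (hW : MemLp W ⊤) (c : ℂ) (p q : Pair d) :
    form W p (c • q) = c * form W p q := by
  simp only [form_eq hW, WithLp.smul_fst, WithLp.smul_snd, map_smul, inner_smul_right]
  ring

lemma form_conj (W : E d → ℝ) (p q : Pair d) : conj (form W p q) = form W q p := by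
  simp only [form, map_add, map_sum, ← integral_conj, map_mul, Complex.conj_conj,
    Complex.conj_ofReal]
  congr 1
  · exact Finset.sum_congr rfl fun i _ => integral_congr_ae (ae_of_all _ fun x => mul_comm _ _)
  · exact integral_congr_ae (ae_of_all _ fun x => by simp only; ring)

lemma form_smul_left {W : E d → ℝ} (hW : MemLp W ⊤) (c : ℂ) (p q : Pair d) :
    form W (c • p) q = conj c * form W p q := by
  rw [← form_conj, form_smul_right hW, map_mul, form_conj]

lemma energy_smul {W : E d → ℝ} (hW : MemLp W ⊤) (c : ℂ) (p : Pair d) :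
    energy W (c • p) = ‖c‖ ^ 2 * energy W p := by
  have h : ((energy W (c • p) : ℝ) : ℂ) = ((‖c‖ ^ 2 * energy W p : ℝ) : ℂ) := by
    rw [← form_self, form_smul_left hW, form_smul_right hW, form_self, ← mul_assoc, mul_comm (conj c),
      Complex.mul_conj, Complex.normSq_eq_norm_sq]
    push_cast
    ring
  exact_mod_cast h

lemma energy_zero_potential (p : Pair d) : energy (fun _ => 0) p = ‖p.snd‖ ^ 2 := by
  rw [energy_eq]; simp

lemma integral_potential_eq {W : E d → ℝ} (hW : MemLp W ⊤) (f : L2 d) :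
    ∫ x, W x * ‖f x‖ ^ 2 = (inner ℂ f (mulL (fun x => (W x : ℂ)) (memLp_ofReal hW) f)).re := by
  have h : ∫ x, ((W x * ‖f x‖ ^ 2 : ℝ) : ℂ)
      = inner ℂ f (mulL (fun x => (W x : ℂ)) (memLp_ofReal hW) f) := by
    rw [inner_L2_eq]
    refine integral_congr_ae ?_
    filter_upwards [coeFn_mulL _ (memLp_ofReal hW) f] with x hx
    rw [hx]
    have : conj (f x) * (W x * f x) = W x * (f x * conj (f x)) := by ring
    rw [this, Complex.mul_conj, Complex.normSq_eq_norm_sq]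
    push_cast
    ring
  rw [← h, integral_complex_ofReal, Complex.ofReal_re]

lemma continuous_integral_potential {W : E d → ℝ} (hW : MemLp W ⊤) :
    Continuous fun f : L2 d => ∫ x, W x * ‖f x‖ ^ 2 := by
  simp only [integral_potential_eq hW]
  fun_prop

lemma integral_potential_ge {W : E d → ℝ} (hW : MemLp W ⊤) (f : L2 d) (hf : ‖f‖ = 1) :
    -‖mulL (fun x => (W x : ℂ)) (memLp_ofReal hW)‖ ≤ ∫ x, W x * ‖f x‖ ^ 2 := by
  rw [integral_potential_eq hW]
  refine neg_le_of_abs_le ((Complex.abs_re_le_norm _).trans ((norm_inner_le_norm _ _).trans ?_))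
  have := (mulL (fun x => (W x : ℂ)) (memLp_ofReal hW)).le_opNorm f
  rw [hf] at this ⊢
  linarith

/-- A vector at which the form `energy - e ‖·‖^2 ≥ 0` vanishes is an eigenvector. -/
lemma isEigenvector_of_energy {U : Set (E d)} {W : E d → ℝ} (hW : MemLp W ⊤) {e : ℝ} {p : Pair d}
    (hp : p ∈ H10 U) (h0 : energy W p = e * ‖p.fst‖ ^ 2)
    (h : ∀ q ∈ H10 U, e * ‖q.fst‖ ^ 2 ≤ energy W q) : IsEigenvector U W e p := by
  refine ⟨hp, fun χ hχ => ?_⟩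
  rw [← inner_L2_eq, ← sub_eq_zero]
  set z := form W χ p - (e : ℂ) * inner ℂ χ.fst p.fst with hz
  set S := energy W χ - e * ‖χ.fst‖ ^ 2 with hS
  -- The nonnegative form `energy - e ‖·‖²` is evaluated along `p - t z χ`, where `z` is its value
  -- on the pair `(χ, p)`. It vanishes at `p`, so a nonzero `z` would give a negative value for
  -- small `t > 0`.
  have key : ∀ t : ℝ, energy W (p + (-(t : ℂ) * z) • χ) - e * ‖(p + (-(t : ℂ) * z) • χ).fst‖ ^ 2
      = ‖z‖ ^ 2 * (-2 * t + t ^ 2 * S) := by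
    intro t
    have hn : ∀ f : L2 d, ((‖f‖ : ℝ) : ℂ) ^ 2 = inner ℂ f f := fun f =>
      (inner_self_eq_norm_sq_to_K (𝕜 := ℂ) f).symm
    have hzc : form W p χ - (e : ℂ) * inner ℂ p.fst χ.fst = conj z := by
      rw [hz, map_sub, map_mul, form_conj, Complex.conj_ofReal, inner_conj_symm]
    have hzz : z * conj z = (‖z‖ : ℂ) ^ 2 := by
      rw [Complex.mul_conj, Complex.normSq_eq_norm_sq]; push_cast; rfl
    have h0' : form W p p = e * inner ℂ p.fst p.fst := by
      rw [form_self, h0]; push_cast; rw [hn]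
    have hS' : form W χ χ - e * inner ℂ χ.fst χ.fst = (S : ℂ) := by
      rw [form_self, hS]; push_cast; rw [hn]
    have hC : ((energy W (p + (-(t : ℂ) * z) • χ)
        - e * ‖(p + (-(t : ℂ) * z) • χ).fst‖ ^ 2 : ℝ) : ℂ)
        = ((‖z‖ ^ 2 * (-2 * t + t ^ 2 * S) : ℝ) : ℂ) := by
      push_cast
      rw [hn, ← form_self]
      simp only [form_add_left hW, form_add_right hW, form_smul_left hW, form_smul_right hW,
        WithLp.add_fst, WithLp.smul_fst, inner_add_left, inner_add_right, inner_smul_left,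
        inner_smul_right, map_mul, map_neg, Complex.conj_ofReal]
      rw [h0', ← hzz, ← hS']
      linear_combination (-(t : ℂ) * z) * hzc + (t : ℂ) * conj z * hz
    exact_mod_cast hC
  -- `t = 1 / (|S| + 1)` is small enough for the linear term to win, whatever the sign of `S`.
  have hneg : -2 * (1 / (|S| + 1)) + (1 / (|S| + 1)) ^ 2 * S < 0 := by
    have h1 : 0 < |S| + 1 := by positivity
    have h2 : (1 / (|S| + 1)) ^ 2 * S ≤ (1 / (|S| + 1)) ^ 2 * (|S| + 1) := by
      gcongr
      linarith [le_abs_self S]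
    have h3 : (1 / (|S| + 1)) ^ 2 * (|S| + 1) = 1 / (|S| + 1) := by field_simp
    have h4 : 0 < 1 / (|S| + 1) := by positivity
    linarith
  have hge := h _ ((H10 U).add_mem hp ((H10 U).smul_mem (-((1 / (|S| + 1) : ℝ) : ℂ) * z) hχ))
  have hk := key (1 / (|S| + 1))
  have hz0 : ‖z‖ ^ 2 ≤ 0 := by
    by_contra hcon
    push Not at hcon
    have := mul_neg_of_pos_of_neg hcon hneg
    linarith
  have : ‖z‖ = 0 := by nlinarith [norm_nonneg z]
  exact norm_eq_zero.1 this

lemma IsEigenvector.energy_eq {U : Set (E d)} {W : E d → ℝ} {μ : ℝ} {p : Pair d}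
    (h : IsEigenvector U W μ p) : energy W p = μ * ‖p.fst‖ ^ 2 := by
  have h1 := h.2 p h.1
  rw [form_self, ← inner_L2_eq, inner_self_eq_norm_sq_to_K] at h1
  have h2 : ((energy W p : ℝ) : ℂ) = ((μ * ‖p.fst‖ ^ 2 : ℝ) : ℂ) := by
    rw [h1]; push_cast; rfl
  exact_mod_cast h2

/-- Pairs carry their gradient as separate data. If the function part vanishes, the eigenvalue
equation tested with the pair itself makes the gradient vanish too. -/
lemma IsEigenvector.fst_ne_zero {U : Set (E d)} {W : E d → ℝ} (hW : MemLp W ⊤) {μ : ℝ} {p : Pair d}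
    (h : IsEigenvector U W μ p) (hp : p ≠ 0) : p.fst ≠ 0 := by
  intro h0
  have h1 := h.energy_eq
  rw [KacLuttinger.energy_eq, integral_potential_eq hW, h0] at h1
  simp only [norm_zero, inner_zero_left, Complex.zero_re] at h1
  have h2 : ‖p.snd‖ = 0 := by nlinarith [norm_nonneg p.snd]
  exact hp ((WithLp.ofLp_injective 2) (Prod.ext h0 (norm_eq_zero.1 h2)))

lemma linearIndependent_const {p : Pair d} (hp : p ≠ 0) :
    LinearIndependent ℂ (fun _ : Fin 1 => p) :=
  linearIndependent_unique_iff.2 hp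

/-- The lowest eigenvalue is attained and is the minimum of the energy. -/
theorem exists_ground {U : Set (E d)} (hU : MeasurableSet U) (hf : volume U ≠ ⊤) {W : E d → ℝ}
    (hW : MemLp W ⊤) (hne : ∃ p ∈ H10 U, ‖p.fst‖ = 1) :
    ∃ p ∈ H10 U, ‖p.fst‖ = 1 ∧ energy W p = eigenvalue U W 1 ∧
      IsEigenvector U W (eigenvalue U W 1) p ∧
      ∀ q ∈ H10 U, eigenvalue U W 1 * ‖q.fst‖ ^ 2 ≤ energy W q := by
  obtain ⟨p, hp, hp1, hmin⟩ := exists_minimizer hU hf (continuous_integral_potential hW)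
    (integral_potential_ge hW) hne
  simp only [← KacLuttinger.energy_eq] at hmin
  have hall : ∀ q ∈ H10 U, energy W p * ‖q.fst‖ ^ 2 ≤ energy W q := by
    intro q hq
    by_cases h0 : q.fst = 0
    · rw [KacLuttinger.energy_eq W q, integral_potential_eq hW, h0]
      simp only [norm_zero, inner_zero_left, Complex.zero_re]
      nlinarith [sq_nonneg ‖q.snd‖]
    · have hpos : 0 < ‖q.fst‖ := norm_pos_iff.2 h0
      have h1 := hmin (((‖q.fst‖⁻¹ : ℝ) : ℂ) • q) ((H10 U).smul_mem _ hq) (by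
        rw [WithLp.smul_fst, norm_smul, Complex.norm_real, norm_inv, norm_norm]
        exact inv_mul_cancel₀ hpos.ne')
      rw [energy_smul hW, Complex.norm_real, norm_inv, norm_norm] at h1
      calc energy W p * ‖q.fst‖ ^ 2 ≤ (‖q.fst‖⁻¹ ^ 2 * energy W q) * ‖q.fst‖ ^ 2 := by gcongr
        _ = energy W q := by field_simp
  have heig : IsEigenvector U W (energy W p) p :=
    isEigenvector_of_energy hW hp (by rw [hp1]; ring) hall
  have hp0 : p ≠ 0 := by
    rintro rfl
    simp at hp1
  have hev : eigenvalue U W 1 = energy W p := by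
    -- Any competitor in the infimum supplies a nonzero eigenvector, whose Rayleigh quotient cannot
    -- lie below the minimum.
    refine IsLeast.csInf_eq ⟨⟨fun _ => p, linearIndependent_const hp0, fun _ => ⟨_, le_rfl, heig⟩⟩,
      ?_⟩
    rintro lam ⟨ψ, hli, hψ⟩
    obtain ⟨μ, hμ, he⟩ := hψ 0
    have h1 := he.fst_ne_zero hW (hli.ne_zero 0)
    have h2 := hall _ he.1
    rw [he.energy_eq] at h2
    have h3 : 0 < ‖(ψ 0).fst‖ ^ 2 := by positivity
    exact (le_of_mul_le_mul_right h2 h3).trans hμ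
  rw [hev]
  exact ⟨p, hp, hp1, rfl, heig, hall⟩

lemma laplacianEigenvalue_two_le {U : Set (E d)} {lam μ₁ μ₂ : ℝ} {p q : Pair d}
    (hli : LinearIndependent ℂ ![p, q]) (hp : IsEigenvector U (fun _ => 0) μ₁ p)
    (hq : IsEigenvector U (fun _ => 0) μ₂ q) (h1 : μ₁ ≤ lam) (h2 : μ₂ ≤ lam) :
    laplacianEigenvalue U 2 ≤ lam := by
  -- The real infimum is only meaningful for a set bounded below; here 0 is a lower bound because
  -- Dirichlet eigenvalues are squared gradient norms divided by squared norms.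
  refine csInf_le ⟨0, ?_⟩ ⟨![p, q], hli, fun i => ?_⟩
  · rintro l ⟨ψ, hψ, hl⟩
    obtain ⟨μ, hμ, he⟩ := hl 0
    have h3 := he.energy_eq
    rw [energy_zero_potential] at h3
    have h4 : 0 < ‖(ψ 0).fst‖ ^ 2 := by
      have := he.fst_ne_zero memLp_zero_potential (hψ.ne_zero 0)
      positivity
    have h5 : 0 ≤ μ := by
      by_contra hcon
      push Not at hcon
      have := mul_neg_of_neg_of_pos hcon h4
      linarith [sq_nonneg ‖(ψ 0).snd‖]
    linarith
  · fin_cases i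
    · exact ⟨μ₁, h1, hp⟩
    · exact ⟨μ₂, h2, hq⟩

/-! ### The chain rule in `H^1_0` -/

/-- A smooth function `ℂ → ℂ` vanishing at the origin with derivative bounded by `L`. -/
structure IsLipSmooth (G : ℂ → ℂ) (L : ℝ) : Prop where
  contDiff : ContDiff ℝ ((⊤ : ℕ∞) : WithTop ℕ∞) G
  map_zero : G 0 = 0
  bound : ∀ z, ‖fderiv ℝ G z‖ ≤ L

namespace IsLipSmooth

variable {G : ℂ → ℂ} {L : ℝ}

lemma differentiable (hG : IsLipSmooth G L) : Differentiable ℝ G :=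
  hG.contDiff.differentiable (by simp)

lemma continuous_fderiv (hG : IsLipSmooth G L) : Continuous (fderiv ℝ G) :=
  hG.contDiff.continuous_fderiv (by simp)

lemma norm_sub_le (hG : IsLipSmooth G L) (z w : ℂ) : ‖G z - G w‖ ≤ L * ‖z - w‖ :=
  convex_univ.norm_image_sub_le_of_norm_fderiv_le (𝕜 := ℝ)
    (fun x _ => hG.differentiable x) (fun x _ => hG.bound x) (Set.mem_univ w) (Set.mem_univ z)

lemma norm_le (hG : IsLipSmooth G L) (z : ℂ) : ‖G z‖ ≤ L * ‖z‖ := by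
  simpa [hG.map_zero] using hG.norm_sub_le z 0

lemma memLp_comp (hG : IsLipSmooth G L) (f : L2 d) : MemLp (fun x => G (f x)) 2 :=
  (Lp.memLp f).of_le_mul (hG.contDiff.continuous.comp_aestronglyMeasurable
    (Lp.aestronglyMeasurable f)) (ae_of_all _ fun x => hG.norm_le (f x))

lemma norm_fderiv_apply_le (hG : IsLipSmooth G L) (z w : ℂ) : ‖fderiv ℝ G z w‖ ≤ L * ‖w‖ :=
  (ContinuousLinearMap.le_opNorm _ _).trans (by gcongr; exact hG.bound z)

lemma aestronglyMeasurable_fderiv (hG : IsLipSmooth G L) (f g : L2 d) :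
    AEStronglyMeasurable (fun x => fderiv ℝ G (f x) (g x)) := by
  have hc : Continuous fun q : ℂ × ℂ => fderiv ℝ G q.1 q.2 :=
    (hG.continuous_fderiv.comp continuous_fst).clm_apply continuous_snd
  exact hc.comp_aestronglyMeasurable
    ((Lp.aestronglyMeasurable f).prodMk (Lp.aestronglyMeasurable g))

lemma memLp_fderiv (hG : IsLipSmooth G L) (f g : L2 d) :
    MemLp (fun x => fderiv ℝ G (f x) (g x)) 2 :=
  (Lp.memLp g).of_le_mul (hG.aestronglyMeasurable_fderiv f g)
    (ae_of_all _ fun x => hG.norm_fderiv_apply_le (f x) (g x))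

/-- The pair `(G ∘ ψ, DG(ψ) ∇ψ)`. -/
def comp (hG : IsLipSmooth G L) (p : Pair d) : Pair d :=
  WithLp.toLp 2 ((hG.memLp_comp p.fst).toLp,
    WithLp.toLp 2 fun i => (hG.memLp_fderiv p.fst (p.snd i)).toLp)

lemma comp_fst (hG : IsLipSmooth G L) (p : Pair d) :
    ((hG.comp p).fst : E d → ℂ) =ᵐ[volume] fun x => G (p.fst x) :=
  (hG.memLp_comp p.fst).coeFn_toLp

lemma comp_snd (hG : IsLipSmooth G L) (p : Pair d) (i : Fin d) :
    ((hG.comp p).snd i : E d → ℂ) =ᵐ[volume] fun x => fderiv ℝ G (p.fst x) (p.snd i x) :=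
  (hG.memLp_fderiv p.fst (p.snd i)).coeFn_toLp

lemma isTestPair_comp (hG : IsLipSmooth G L) {U : Set (E d)} {p : Pair d} (hp : IsTestPair U p) :
    IsTestPair U (hG.comp p) := by
  obtain ⟨φ, h1, h2, h3, h4, h5⟩ := hp
  have hs : tsupport (G ∘ φ) ⊆ tsupport φ :=
    closure_mono (Function.support_comp_subset hG.map_zero φ)
  refine ⟨G ∘ φ, hG.contDiff.comp h1, h2.comp_left hG.map_zero, hs.trans h3, ?_, fun i => ?_⟩
  · filter_upwards [h4, hG.comp_fst p] with x e1 e2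
    rw [e2, e1]; rfl
  · filter_upwards [h4, h5 i, hG.comp_snd p i] with x e1 e2 e3
    rw [e3, e1, e2, fderiv_comp x (hG.differentiable _) (h1.differentiable (by simp) x)]
    rfl

/-- The derivative of `G` is bounded and continuous but need not be Lipschitz, so convergence comes
from dominated convergence along an almost everywhere convergent sequence, with dominating function
`(2L)² |g|²`. -/
lemma tendsto_fderiv_left (hG : IsLipSmooth G L) {f : ℕ → L2 d} {f₀ : L2 d} (g : L2 d)
    (h : ∀ᵐ x, Tendsto (fun n => f n x) atTop (𝓝 (f₀ x))) :
    Tendsto (fun n => (hG.memLp_fderiv (f n) g).toLp) atTop (𝓝 (hG.memLp_fderiv f₀ g).toLp) := by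
  rw [tendsto_iff_norm_sub_tendsto_zero]
  have hsq : Tendsto (fun n =>
      ‖(hG.memLp_fderiv (f n) g).toLp - (hG.memLp_fderiv f₀ g).toLp‖ ^ 2) atTop (𝓝 0) := by
    have e : ∀ n, ‖(hG.memLp_fderiv (f n) g).toLp - (hG.memLp_fderiv f₀ g).toLp‖ ^ 2
        = ∫ x, ‖fderiv ℝ G (f n x) (g x) - fderiv ℝ G (f₀ x) (g x)‖ ^ 2 := by
      intro n
      rw [← integral_norm_sq_L2]
      refine integral_congr_ae ?_
      filter_upwards [Lp.coeFn_sub (hG.memLp_fderiv (f n) g).toLp (hG.memLp_fderiv f₀ g).toLp,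
        (hG.memLp_fderiv (f n) g).coeFn_toLp, (hG.memLp_fderiv f₀ g).coeFn_toLp] with x h1 h2 h3
      rw [h1, Pi.sub_apply, h2, h3]
    simp only [e]
    have h0 : (0 : ℝ) = ∫ _ : E d, (0 : ℝ) := by simp
    rw [h0]
    refine tendsto_integral_of_dominated_convergence (fun x => (2 * L) ^ 2 * ‖g x‖ ^ 2)
      (fun n => ?_) ((integrable_norm_sq_L2 g).const_mul _) (fun n => ae_of_all _ fun x => ?_) ?_
    · exact (((hG.aestronglyMeasurable_fderiv (f n) g).sub
        (hG.aestronglyMeasurable_fderiv f₀ g)).norm.pow 2)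
    · rw [Real.norm_eq_abs, abs_of_nonneg (by positivity), ← mul_pow]
      gcongr
      refine (_root_.norm_sub_le _ _).trans ?_
      linarith [hG.norm_fderiv_apply_le (f n x) (g x), hG.norm_fderiv_apply_le (f₀ x) (g x)]
    · filter_upwards [h] with x hx
      have hc : Continuous fun z => fderiv ℝ G z (g x) :=
        hG.continuous_fderiv.clm_apply continuous_const
      have h1 := (((hc.tendsto (f₀ x)).comp hx).sub_const (fderiv ℝ G (f₀ x) (g x))).norm.pow 2
      simpa using h1
  have := hsq.sqrt
  simpa [Real.sqrt_sq] using this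

lemma norm_fderiv_sub_le (hG : IsLipSmooth G L) (f g g' : L2 d) :
    ‖(hG.memLp_fderiv f g).toLp - (hG.memLp_fderiv f g').toLp‖ ≤ L * ‖g - g'‖ := by
  refine Lp.norm_le_mul_norm_of_ae_le_mul ?_
  filter_upwards [Lp.coeFn_sub (hG.memLp_fderiv f g).toLp (hG.memLp_fderiv f g').toLp,
    (hG.memLp_fderiv f g).coeFn_toLp, (hG.memLp_fderiv f g').coeFn_toLp, Lp.coeFn_sub g g']
    with x h1 h2 h3 h4
  rw [h1, Pi.sub_apply, h2, h3, h4, Pi.sub_apply, ← map_sub]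
  exact hG.norm_fderiv_apply_le _ _

lemma norm_comp_sub_le (hG : IsLipSmooth G L) (f g : L2 d) :
    ‖(hG.memLp_comp f).toLp - (hG.memLp_comp g).toLp‖ ≤ L * ‖f - g‖ := by
  refine Lp.norm_le_mul_norm_of_ae_le_mul ?_
  filter_upwards [Lp.coeFn_sub (hG.memLp_comp f).toLp (hG.memLp_comp g).toLp,
    (hG.memLp_comp f).coeFn_toLp, (hG.memLp_comp g).coeFn_toLp, Lp.coeFn_sub f g]
    with x h1 h2 h3 h4
  rw [h1, Pi.sub_apply, h2, h3, h4, Pi.sub_apply]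
  exact hG.norm_sub_le _ _

/-- The chain rule: `G ∘ ψ ∈ H^1_0(U)` with gradient `DG(ψ) ∇ψ`. -/
theorem comp_mem_H10 (hG : IsLipSmooth G L) {U : Set (E d)} {p : Pair d} (hp : p ∈ H10 U) :
    hG.comp p ∈ H10 U := by
  have hp' : p ∈ closure {p | IsTestPair U p} := by rw [← coe_H10]; exact hp
  obtain ⟨u, hu, hup⟩ := mem_closure_iff_seq_limit.1 hp'
  have hfst : Tendsto (fun n => (u n).fst) atTop (𝓝 p.fst) := (fstL.continuous.tendsto p).comp hup
  -- `L^2` convergence gives almost everywhere convergence only along a subsequence, which is enough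
  -- for membership in a closed set.
  have hm := tendstoInMeasure_of_tendsto_Lp hfst
  obtain ⟨s, hs, hae⟩ := hm.exists_seq_tendsto_ae
  have hmem : ∀ n, hG.comp (u (s n)) ∈ H10 U := fun n => (hG.isTestPair_comp (hu (s n))).mem_H10
  refine (isClosed_H10 U).mem_of_tendsto (b := atTop) (f := fun n => hG.comp (u (s n))) ?_
    (Eventually.of_forall hmem)
  have h1 : Tendsto (fun n => (hG.memLp_comp (u (s n)).fst).toLp) atTop
      (𝓝 (hG.memLp_comp p.fst).toLp) := by
    rw [tendsto_iff_norm_sub_tendsto_zero]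
    refine squeeze_zero (fun n => norm_nonneg _) (fun n => hG.norm_comp_sub_le _ _) ?_
    have := (tendsto_iff_norm_sub_tendsto_zero.1 (hfst.comp hs.tendsto_atTop)).const_mul L
    simpa using this
  have h2 : ∀ i, Tendsto (fun n => (hG.memLp_fderiv (u (s n)).fst ((u (s n)).snd i)).toLp) atTop
      (𝓝 (hG.memLp_fderiv p.fst (p.snd i)).toLp) := by
    intro i
    have hi : Tendsto (fun n => (u n).snd i) atTop (𝓝 (p.snd i)) :=
      ((sndL i).continuous.tendsto p).comp hup
    -- Two-step approximation of the gradient: first vary the point at which `DG` is taken, with the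
    -- limit gradient fixed, then vary the gradient, where `DG` is bounded by `L`.
    have hA := hG.tendsto_fderiv_left (p.snd i) hae
    have hB : Tendsto (fun n => (hG.memLp_fderiv (u (s n)).fst ((u (s n)).snd i)).toLp
        - (hG.memLp_fderiv (u (s n)).fst (p.snd i)).toLp) atTop (𝓝 0) := by
      rw [tendsto_zero_iff_norm_tendsto_zero]
      refine squeeze_zero (fun n => norm_nonneg _) (fun n => hG.norm_fderiv_sub_le _ _ _) ?_
      have := (tendsto_iff_norm_sub_tendsto_zero.1 (hi.comp hs.tendsto_atTop)).const_mul L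
      simpa using this
    simpa using hB.add hA
  exact ((WithLp.prod_continuous_toLp 2 _ _).tendsto _).comp
    (h1.prodMk_nhds (((PiLp.continuous_toLp 2 _).tendsto _).comp (tendsto_pi_nhds.2 h2)))

end IsLipSmooth

/-! ### The `L^4` bound for Dirichlet eigenfunctions -/

/-- The truncated cube `|z|^2 z / (1 + ε |z|^2)`. -/
def cubeTrunc (ε : ℝ) (z : ℂ) : ℂ := (‖z‖ ^ 2 * (1 + ε * ‖z‖ ^ 2)⁻¹) • z

/-- The truncated square `|z|^2 / √(1 + ε |z|^2)`. -/
def sqTrunc (ε : ℝ) (z : ℂ) : ℂ := Complex.ofRealCLM (‖z‖ ^ 2 * (√(1 + ε * ‖z‖ ^ 2))⁻¹)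

section trunc

variable {ε : ℝ}

lemma one_add_pos (hε : 0 < ε) (z : ℂ) : 0 < 1 + ε * ‖z‖ ^ 2 := by positivity

lemma hasFDerivAt_normSq (z : ℂ) :
    HasFDerivAt (fun z : ℂ => ‖z‖ ^ 2) (2 • (innerSL ℝ z : ℂ →L[ℝ] ℝ)) z :=
  (hasStrictFDerivAt_norm_sq z).hasFDerivAt

lemma fderiv_cubeTrunc (hε : 0 < ε) (z w : ℂ) : fderiv ℝ (cubeTrunc ε) z w =
    (‖z‖ ^ 2 / (1 + ε * ‖z‖ ^ 2)) • w + (2 * inner ℝ z w / (1 + ε * ‖z‖ ^ 2) ^ 2) • z := by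
  have hp := one_add_pos hε z
  have h1 : HasDerivAt (fun t : ℝ => t * (1 + ε * t)⁻¹) (1 / (1 + ε * ‖z‖ ^ 2) ^ 2) (‖z‖ ^ 2) := by
    have := (hasDerivAt_id (‖z‖ ^ 2)).mul
      ((((hasDerivAt_id (‖z‖ ^ 2)).const_mul ε).const_add 1).inv hp.ne')
    refine this.congr_deriv ?_
    simp only [id, Pi.inv_apply]
    field_simp
    ring
  have h2 := (h1.comp_hasFDerivAt z (hasFDerivAt_normSq z)).smul (hasFDerivAt_id z)
  have h3 : fderiv ℝ (cubeTrunc ε) z = _ := h2.fderiv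
  rw [h3]
  simp only [add_apply, ContinuousLinearMap.smulRight_apply,
    smul_apply, innerSL_apply_apply, Function.comp, id,
    ContinuousLinearMap.id_apply, smul_eq_mul, nsmul_eq_mul]
  congr 1
  congr 1
  push_cast
  field_simp

lemma fderiv_sqTrunc (hε : 0 < ε) (z w : ℂ) : fderiv ℝ (sqTrunc ε) z w =
    ((inner ℝ z w * (2 + ε * ‖z‖ ^ 2) / (√(1 + ε * ‖z‖ ^ 2)) ^ 3 : ℝ) : ℂ) := by
  have hp := one_add_pos hε z
  have hs : 0 < √(1 + ε * ‖z‖ ^ 2) := Real.sqrt_pos.2 hp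
  have hss : √(1 + ε * ‖z‖ ^ 2) ^ 2 = 1 + ε * ‖z‖ ^ 2 := Real.sq_sqrt hp.le
  have h1 : HasDerivAt (fun t : ℝ => t * (√(1 + ε * t))⁻¹)
      ((2 + ε * ‖z‖ ^ 2) / (2 * (√(1 + ε * ‖z‖ ^ 2)) ^ 3)) (‖z‖ ^ 2) := by
    have := (hasDerivAt_id (‖z‖ ^ 2)).mul
      (((((hasDerivAt_id (‖z‖ ^ 2)).const_mul ε).const_add 1).sqrt hp.ne').inv hs.ne')
    refine this.congr_deriv ?_
    simp only [id, Pi.inv_apply]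
    rw [hss]
    have h4 : √(1 + ε * ‖z‖ ^ 2) ^ 3 = (1 + ε * ‖z‖ ^ 2) * √(1 + ε * ‖z‖ ^ 2) := by
      rw [pow_succ, hss]
    rw [h4]
    field_simp
    ring
  have h2 := (Complex.ofRealCLM.hasFDerivAt).comp z
    (h1.comp_hasFDerivAt z (hasFDerivAt_normSq z))
  have h3 : fderiv ℝ (sqTrunc ε) z = _ := h2.fderiv
  rw [h3]
  simp only [ContinuousLinearMap.comp_apply, smul_apply, innerSL_apply_apply,
    smul_eq_mul, nsmul_eq_mul, Complex.ofRealCLM_apply]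
  congr 1
  push_cast
  field_simp

lemma isLipSmooth_cubeTrunc (hε : 0 < ε) : IsLipSmooth (cubeTrunc ε) (3 / ε) where
  contDiff := by
    have h : ContDiff ℝ ((⊤ : ℕ∞) : WithTop ℕ∞) fun z : ℂ => ‖z‖ ^ 2 := contDiff_norm_sq ℝ
    exact (h.mul ((contDiff_const.add (contDiff_const.mul h)).inv
      fun z => (one_add_pos hε z).ne')).smul contDiff_id
  map_zero := by simp [cubeTrunc]
  bound z := by
    have hp := one_add_pos hε z
    refine ContinuousLinearMap.opNorm_le_bound _ (by positivity) fun w => ?_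
    rw [fderiv_cubeTrunc hε]
    have hin : |inner ℝ z w| ≤ ‖z‖ * ‖w‖ := abs_real_inner_le_norm z w
    have hq : ‖z‖ ^ 2 / (1 + ε * ‖z‖ ^ 2) ≤ 1 / ε := by
      rw [div_le_div_iff₀ hp hε]; nlinarith
    calc _ ≤ ‖z‖ ^ 2 / (1 + ε * ‖z‖ ^ 2) * ‖w‖ + 2 * |inner ℝ z w| / (1 + ε * ‖z‖ ^ 2) ^ 2 * ‖z‖ := by
          refine (norm_add_le _ _).trans (le_of_eq ?_)
          rw [norm_smul, norm_smul, Real.norm_eq_abs, Real.norm_eq_abs, abs_div, abs_div, abs_mul,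
            abs_of_nonneg (sq_nonneg ‖z‖), abs_of_pos hp, abs_of_pos (pow_pos hp 2), abs_two]
      _ ≤ ‖z‖ ^ 2 / (1 + ε * ‖z‖ ^ 2) * ‖w‖
          + 2 * (‖z‖ * ‖w‖) / (1 + ε * ‖z‖ ^ 2) * ‖z‖ := by
          have h1 : 1 + ε * ‖z‖ ^ 2 ≤ (1 + ε * ‖z‖ ^ 2) ^ 2 := by
            have : 0 ≤ ε * ‖z‖ ^ 2 := by positivity
            nlinarith
          gcongr
      _ = 3 * (‖z‖ ^ 2 / (1 + ε * ‖z‖ ^ 2)) * ‖w‖ := by ring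
      _ ≤ 3 * (1 / ε) * ‖w‖ := by gcongr
      _ = 3 / ε * ‖w‖ := by ring

/-- With `s = ⟨z, w⟩` and `a = ε|z|²`, Cauchy-Schwarz `s² ≤ |z|²|w|²` reduces the claim to `(2 + a)²
≤ (4/3)(3 + a)(1 + a)`. Equality at `a = 0` explains the constant: without truncation it compares
`4s²` with `|z|²|w|² + 2s² ≥ 3s²`. -/
lemma norm_fderiv_sqTrunc_sq_le (hε : 0 < ε) (z w : ℂ) :
    ‖fderiv ℝ (sqTrunc ε) z w‖ ^ 2
      ≤ 4 / 3 * (conj (fderiv ℝ (cubeTrunc ε) z w) * w).re := by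
  have hp := one_add_pos hε z
  have hss : √(1 + ε * ‖z‖ ^ 2) ^ 2 = 1 + ε * ‖z‖ ^ 2 := Real.sq_sqrt hp.le
  have hre : (conj (fderiv ℝ (cubeTrunc ε) z w) * w).re
      = ‖z‖ ^ 2 / (1 + ε * ‖z‖ ^ 2) * ‖w‖ ^ 2 + 2 * (inner ℝ z w) ^ 2 / (1 + ε * ‖z‖ ^ 2) ^ 2 := by
    have : (conj (fderiv ℝ (cubeTrunc ε) z w) * w).re
        = inner ℝ (fderiv ℝ (cubeTrunc ε) z w) w := by
      rw [Complex.inner, mul_comm]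
    rw [this, fderiv_cubeTrunc hε, inner_add_left, real_inner_smul_left, real_inner_smul_left,
      real_inner_self_eq_norm_sq]
    ring
  have hcs : (inner ℝ z w) ^ 2 ≤ ‖z‖ ^ 2 * ‖w‖ ^ 2 := by
    rw [← mul_pow, ← sq_abs]
    gcongr
    exact abs_real_inner_le_norm z w
  rw [hre, fderiv_sqTrunc hε, Complex.norm_real, Real.norm_eq_abs, sq_abs, div_pow, ← pow_mul,
    show 3 * 2 = 2 * 3 from rfl, pow_mul, hss]
  set a := ε * ‖z‖ ^ 2 with ha
  have ha0 : 0 ≤ a := by positivity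
  set s := inner ℝ z w with hs
  calc (s * (2 + a)) ^ 2 / (1 + a) ^ 3 = s ^ 2 * (2 + a) ^ 2 / (1 + a) ^ 3 := by ring
    _ ≤ 4 / 3 * (s ^ 2 * (3 + a) * (1 + a) / (1 + a) ^ 3) := by
      rw [← mul_div_assoc]
      gcongr ?_ / _
      nlinarith [mul_nonneg (sq_nonneg s) ha0, mul_nonneg (sq_nonneg s) (mul_nonneg ha0 ha0)]
    _ = 4 / 3 * (s ^ 2 / (1 + a) + 2 * s ^ 2 / (1 + a) ^ 2) := by
      field_simp
      ring
    _ ≤ 4 / 3 * (‖z‖ ^ 2 * ‖w‖ ^ 2 / (1 + a) + 2 * s ^ 2 / (1 + a) ^ 2) := by gcongr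
    _ = _ := by ring

lemma isLipSmooth_sqTrunc (hε : 0 < ε) : IsLipSmooth (sqTrunc ε) (2 / √ε) where
  contDiff := by
    have h : ContDiff ℝ ((⊤ : ℕ∞) : WithTop ℕ∞) fun z : ℂ => ‖z‖ ^ 2 := contDiff_norm_sq ℝ
    exact Complex.ofRealCLM.contDiff.comp (h.mul (((contDiff_const.add (contDiff_const.mul h)).sqrt
      fun z => (one_add_pos hε z).ne').inv fun z => (Real.sqrt_pos.2 (one_add_pos hε z)).ne'))
  map_zero := by simp [sqTrunc]
  bound z := by
    refine ContinuousLinearMap.opNorm_le_bound _ (by positivity) fun w => ?_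
    refine le_of_sq_le_sq ?_ (by positivity)
    refine (norm_fderiv_sqTrunc_sq_le hε z w).trans ?_
    have h1 := (Complex.re_le_norm _).trans (norm_mul_le (conj (fderiv ℝ (cubeTrunc ε) z w)) w)
    rw [RCLike.norm_conj] at h1
    have h2 := (isLipSmooth_cubeTrunc hε).norm_fderiv_apply_le z w
    -- The Lipschitz constant is inherited from the cube through the comparison of derivatives:
    -- `(2/√ε)² = (4/3)(3/ε)`.
    have h3 : (2 / √ε * ‖w‖) ^ 2 = 4 / 3 * (3 / ε * ‖w‖ * ‖w‖) := by
      rw [mul_pow, div_pow, Real.sq_sqrt hε.le]; ring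
    rw [h3]
    gcongr
    exact h1.trans (by gcongr)

lemma norm_sqTrunc (z : ℂ) : ‖sqTrunc ε z‖ = ‖z‖ ^ 2 * (√(1 + ε * ‖z‖ ^ 2))⁻¹ := by
  rw [sqTrunc, Complex.ofRealCLM_apply, Complex.norm_real, Real.norm_eq_abs,
    abs_of_nonneg (by positivity)]

lemma norm_sqTrunc_le (hε : 0 < ε) (z : ℂ) : ‖sqTrunc ε z‖ ≤ ‖z‖ ^ 2 := by
  rw [norm_sqTrunc]
  refine mul_le_of_le_one_right (by positivity) (inv_le_one_of_one_le₀ ?_)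
  rw [Real.one_le_sqrt]
  have : 0 ≤ ε * ‖z‖ ^ 2 := by positivity
  linarith

/-- This identity dictates the pair of truncations: testing an eigenfunction against its truncated
cube produces exactly the mass of its truncated square. Truncation is needed because `|z|²z` is not
Lipschitz. -/
lemma conj_cubeTrunc_mul (hε : 0 < ε) (z : ℂ) :
    conj (cubeTrunc ε z) * z = ((‖sqTrunc ε z‖ ^ 2 : ℝ) : ℂ) := by
  rw [norm_sqTrunc, mul_pow, inv_pow, Real.sq_sqrt (one_add_pos hε z).le, cubeTrunc,
    Complex.real_smul, map_mul, Complex.conj_ofReal, mul_assoc, mul_comm (conj z), Complex.mul_conj,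
    Complex.normSq_eq_norm_sq]
  push_cast
  ring

end trunc

/-! ### Positivity of Dirichlet eigenvalues and uniform bounds for the truncated square -/

lemma IsEigenvector.eigenvalue_eq_norm_sq {U : Set (E d)} {lam : ℝ} {p : Pair d}
    (h : IsEigenvector U (fun _ => 0) lam p) (h1 : ‖p.fst‖ = 1) : lam = ‖p.snd‖ ^ 2 := by
  have := h.energy_eq
  rw [energy_zero_potential, h1] at this
  linarith

/-- If the eigenvalue were zero the gradient would vanish, and the Fourier inequality would read `3
≤ e² m² (8πt)^(-d/2)` with `m` a bound on the `L^1` norm. This fails for large `t`. -/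
lemma IsEigenvector.eigenvalue_pos (hd : 2 ≤ d) {U : Set (E d)} (hU : MeasurableSet U)
    (hf : volume U ≠ ⊤) {lam : ℝ} {p : Pair d} (h : IsEigenvector U (fun _ => 0) lam p)
    (h1 : ‖p.fst‖ = 1) : 0 < lam := by
  have h2 := h.eigenvalue_eq_norm_sq h1
  rcases (h2 ▸ sq_nonneg ‖p.snd‖ : 0 ≤ lam).lt_or_eq with h3 | h3
  · exact h3
  exfalso
  set m := volume.real U + 1 with hm
  have hmpos : 0 < m := by positivity
  -- `x` stands for `1 / (8πt)`. Since `x ≤ 1` and `d ≥ 2`, `x^(d/2) ≤ x`, and the choice makes `e²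
  -- m² x ≤ 1`.
  set x := 1 / (1 + Real.exp 2 * m ^ 2) with hx
  have hxpos : 0 < x := by positivity
  have hx1 : x ≤ 1 := by
    rw [hx, div_le_one (by positivity)]
    have : 0 ≤ Real.exp 2 * m ^ 2 := by positivity
    linarith
  have ht : 0 < 1 / (8 * Real.pi * x) := by positivity
  have h4 := three_mul_norm_sq_le hU hf ht h.1
  have h5 := gaussMass_le (U := U) (b := 8 * Real.pi ^ 2 * (1 / (8 * Real.pi * x))) (by positivity)
    (f := p.fst) (m := m) (by
      have := integral_norm_indicator_le hU hf p.fst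
      rw [h1] at this
      linarith)
  have h6 : Real.pi / (8 * Real.pi ^ 2 * (1 / (8 * Real.pi * x))) = x := by
    have := Real.pi_pos
    field_simp
  have h7 : x ^ ((d : ℝ) / 2) ≤ x := by
    have hd' : (2 : ℝ) ≤ d := by exact_mod_cast hd
    have := Real.rpow_le_rpow_of_exponent_ge hxpos hx1 (show (1 : ℝ) ≤ (d : ℝ) / 2 by linarith)
    rwa [Real.rpow_one] at this
  rw [h6] at h5
  rw [h1, ← h2, ← h3] at h4
  have h8 : Real.exp 2 * gaussMass U (8 * Real.pi ^ 2 * (1 / (8 * Real.pi * x))) p.fst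
      ≤ Real.exp 2 * (m ^ 2 * x) := by
    gcongr
    exact h5.trans (by gcongr)
  have h9 : Real.exp 2 * (m ^ 2 * x) ≤ 1 := by
    rw [hx, ← mul_assoc, mul_one_div, div_le_one (by positivity)]
    linarith
  linarith

lemma integrable_conj_mul (f g : L2 d) : Integrable fun x => conj (f x) * g x := by
  refine (L2.integrable_inner (𝕜 := ℂ) f g).congr (ae_of_all _ fun x => ?_)
  simp [mul_comm]

/-- The gradient of the truncated square of an eigenfunction. -/
lemma norm_snd_sqTrunc_le {ε : ℝ} (hε : 0 < ε) {U : Set (E d)} {lam : ℝ} {p : Pair d}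
    (h : IsEigenvector U (fun _ => 0) lam p) :
    ‖((isLipSmooth_sqTrunc hε).comp p).snd‖ ^ 2
      ≤ 4 / 3 * lam * ‖((isLipSmooth_sqTrunc hε).comp p).fst‖ ^ 2 := by
  set γ := (isLipSmooth_cubeTrunc hε).comp p with hγ
  set η := (isLipSmooth_sqTrunc hε).comp p with hη
  -- The truncated cube is admissible by the chain rule; testing with it gives `Re ∫ conj ∇γ · ∇φ =
  -- lam ‖η‖²`.
  have h1 := h.2 γ ((isLipSmooth_cubeTrunc hε).comp_mem_H10 h.1)
  have h2 : ∫ x, conj (γ.fst x) * p.fst x = ((‖η.fst‖ ^ 2 : ℝ) : ℂ) := by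
    rw [← integral_norm_sq_L2, ← integral_complex_ofReal]
    refine integral_congr_ae ?_
    filter_upwards [(isLipSmooth_cubeTrunc hε).comp_fst p, (isLipSmooth_sqTrunc hε).comp_fst p]
      with x e1 e2
    rw [e1, e2, conj_cubeTrunc_mul hε]
  have h3 : (form (fun _ => 0) γ p).re = ∑ i, ∫ x, (conj (γ.snd i x) * p.snd i x).re := by
    simp only [form, Complex.ofReal_zero, zero_mul, integral_zero, add_zero, Complex.re_sum]
    exact Finset.sum_congr rfl fun i _ => (integral_re (integrable_conj_mul _ _)).symm
  have h4 : ‖η.snd‖ ^ 2 ≤ 4 / 3 * (form (fun _ => 0) γ p).re := by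
    rw [h3, ← sum_integral_snd, Finset.mul_sum]
    refine Finset.sum_le_sum fun i _ => ?_
    rw [← integral_const_mul]
    refine integral_mono_ae (integrable_norm_sq_L2 _)
      ((integrable_conj_mul _ _).re.const_mul _) ?_
    filter_upwards [(isLipSmooth_cubeTrunc hε).comp_snd p i, (isLipSmooth_sqTrunc hε).comp_snd p i]
      with x e1 e2
    rw [e1, e2]
    exact norm_fderiv_sqTrunc_sq_le hε _ _
  rw [h1, h2, ← Complex.ofReal_mul, Complex.ofReal_re] at h4
  linarith

/-- The truncated square has `L^1` norm at most `‖φ‖² = 1`, and its gradient is controlled by its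
own mass. The Fourier inequality therefore closes on itself, with a bound independent of `ε`. -/
lemma norm_fst_sqTrunc_le (hd : 2 ≤ d) {ε : ℝ} (hε : 0 < ε) {U : Set (E d)} (hU : MeasurableSet U)
    (hf : volume U ≠ ⊤) {lam : ℝ} {p : Pair d} (h : IsEigenvector U (fun _ => 0) lam p)
    (h1 : ‖p.fst‖ = 1) :
    ‖((isLipSmooth_sqTrunc hε).comp p).fst‖ ^ 2
      ≤ Real.exp 2 * (lam / (6 * Real.pi)) ^ ((d : ℝ) / 2) := by
  have hlam := h.eigenvalue_pos hd hU hf h1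
  have h2 := norm_snd_sqTrunc_le hε h
  set η := (isLipSmooth_sqTrunc hε).comp p with hη
  -- `t = 3 / (4 lam)` turns the gradient term into exactly `2‖η‖²`, leaving `‖η‖²` on the left, and
  -- makes `π / (8π²t) = lam / (6π)`.
  have ht : 0 < 3 / (4 * lam) := by positivity
  have h3 := three_mul_norm_sq_le hU hf ht ((isLipSmooth_sqTrunc hε).comp_mem_H10 h.1)
  rw [← hη] at h3
  have h4 : ∫ x, ‖U.indicator η.fst x‖ ≤ 1 := by
    have h5 : (1 : ℝ) = ∫ x, ‖p.fst x‖ ^ 2 := by rw [integral_norm_sq_L2, h1]; norm_num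
    rw [h5]
    refine integral_mono_ae (integrable_indicator_L2 hU hf _).norm (integrable_norm_sq_L2 _) ?_
    filter_upwards [(isLipSmooth_sqTrunc hε).comp_fst p] with x e1
    refine (norm_indicator_le_norm_self _ _).trans ?_
    rw [e1]
    exact norm_sqTrunc_le hε _
  have h5 := gaussMass_le (b := 8 * Real.pi ^ 2 * (3 / (4 * lam))) (by positivity) h4
  have h6 : Real.pi / (8 * Real.pi ^ 2 * (3 / (4 * lam))) = lam / (6 * Real.pi) := by
    have := Real.pi_pos
    field_simp
    norm_num
  rw [h6, one_pow, one_mul] at h5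
  have h7 : 2 * (3 / (4 * lam)) * ‖η.snd‖ ^ 2 ≤ 2 * ‖η.fst‖ ^ 2 := by
    calc 2 * (3 / (4 * lam)) * ‖η.snd‖ ^ 2
        ≤ 2 * (3 / (4 * lam)) * (4 / 3 * lam * ‖η.fst‖ ^ 2) := by gcongr
      _ = 2 * ‖η.fst‖ ^ 2 := by field_simp
  have h8 := mul_le_mul_of_nonneg_left h5 (Real.exp_pos 2).le
  linarith

/-- The `L^4` bound for normalized Dirichlet eigenfunctions. -/
theorem lintegral_norm_pow_four_le (hd : 2 ≤ d) {U : Set (E d)} (hU : MeasurableSet U)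
    (hf : volume U ≠ ⊤) {lam : ℝ} {p : Pair d} (h : IsEigenvector U (fun _ => 0) lam p)
    (h1 : ‖p.fst‖ = 1) :
    ∫⁻ x, ENNReal.ofReal (‖p.fst x‖ ^ 4)
      ≤ ENNReal.ofReal (Real.exp 2 * (lam / (6 * Real.pi)) ^ ((d : ℝ) / 2)) := by
  have hpos : ∀ n : ℕ, (0 : ℝ) < 1 / ((n : ℝ) + 1) := fun n => by positivity
  have hle : ∀ n : ℕ, ∫⁻ x, ENNReal.ofReal (‖sqTrunc (1 / ((n : ℝ) + 1)) (p.fst x)‖ ^ 2)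
      ≤ ENNReal.ofReal (Real.exp 2 * (lam / (6 * Real.pi)) ^ ((d : ℝ) / 2)) := fun n => by
    refine le_trans (le_of_eq ?_)
      (ENNReal.ofReal_le_ofReal (norm_fst_sqTrunc_le hd (hpos n) hU hf h h1))
    rw [← integral_norm_sq_L2, ofReal_integral_eq_lintegral_ofReal (integrable_norm_sq_L2 _)
      (ae_of_all _ fun x => by positivity)]
    refine lintegral_congr_ae ?_
    filter_upwards [(isLipSmooth_sqTrunc (hpos n)).comp_fst p] with x e
    rw [e]
  have hlim : ∀ x, Tendsto (fun n : ℕ => ENNReal.ofReal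
      (‖sqTrunc (1 / ((n : ℝ) + 1)) (p.fst x)‖ ^ 2)) atTop (𝓝 (ENNReal.ofReal (‖p.fst x‖ ^ 4))) := by
    intro x
    refine (ENNReal.continuous_ofReal.tendsto _).comp ?_
    simp only [norm_sqTrunc]
    have h0 := tendsto_one_div_add_atTop_nhds_zero_nat (𝕜 := ℝ)
    have h2 := ((((h0.mul_const (‖p.fst x‖ ^ 2)).const_add 1).sqrt.inv₀ (by simp)).const_mul
      (‖p.fst x‖ ^ 2)).pow 2
    convert h2 using 2
    simp
    ring
  -- Fatou's lemma as `ε = 1/(n+1)` tends to 0. Working with the lower integral makes finiteness of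
  -- the `L^4` norm part of the conclusion.
  calc ∫⁻ x, ENNReal.ofReal (‖p.fst x‖ ^ 4)
      = ∫⁻ x, liminf (fun n : ℕ => ENNReal.ofReal
          (‖sqTrunc (1 / ((n : ℝ) + 1)) (p.fst x)‖ ^ 2)) atTop :=
        lintegral_congr fun x => (hlim x).liminf_eq.symm
    _ ≤ liminf (fun n : ℕ => ∫⁻ x, ENNReal.ofReal
          (‖sqTrunc (1 / ((n : ℝ) + 1)) (p.fst x)‖ ^ 2)) atTop := by
        refine lintegral_liminf_le' fun n => ?_
        exact ((((isLipSmooth_sqTrunc (hpos n)).memLp_comp p.fst).1.norm.aemeasurable).pow_const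
          2).ennreal_ofReal
    _ ≤ _ := by
        refine liminf_le_of_frequently_le' (Frequently.of_forall hle)

/-! ### The self-interaction and the mean-field potential -/

/-- The potential `v * |f|^2`. -/
def convSq (v : E d → ℝ) (f : L2 d) (x : E d) : ℝ := ∫ y, v (x - y) * ‖f y‖ ^ 2

lemma selfInteraction_eq (v : E d → ℝ) (u : Pair d) :
    selfInteraction v u = ∫ x, convSq v u.fst x * ‖u.fst x‖ ^ 2 := by
  refine integral_congr_ae (ae_of_all _ fun x => ?_)
  simp only [convSq]
  rw [← integral_mul_const]
  refine integral_congr_ae (ae_of_all _ fun y => ?_)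
  simp only
  ring

lemma meanField_eq (N : ℕ) (v : E d → ℝ) (u : Pair d) (x : E d) :
    meanField N v u x = ((N : ℝ) - 1) * convSq v u.fst x - ((N : ℝ) - 1) / 2 * selfInteraction v u :=
  rfl

namespace IsInteraction

variable {v : E d → ℝ}

lemma exists_bound (hv : IsInteraction v) : ∃ M, 0 ≤ M ∧ ∀ᵐ x, ‖v x‖ ≤ M := by
  refine ⟨(eLpNorm v ⊤ volume).toReal, ENNReal.toReal_nonneg, ?_⟩
  have h := ae_le_eLpNormEssSup (f := v) (μ := (volume : Measure (E d)))
  have hfin : eLpNorm v ⊤ volume ≠ ⊤ := hv.essBounded.2.ne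
  filter_upwards [h] with x hx
  rw [← eLpNorm_exponent_top] at hx
  have := ENNReal.toReal_mono hfin hx
  rwa [toReal_enorm] at this

lemma ae_comp_sub {M : ℝ} (h : ∀ᵐ x, ‖v x‖ ≤ M) (x : E d) : ∀ᵐ y, ‖v (x - y)‖ ≤ M :=
  (Measure.measurePreserving_sub_left volume x).quasiMeasurePreserving.ae h

lemma aestronglyMeasurable_comp_sub (hv : IsInteraction v) (x : E d) :
    AEStronglyMeasurable fun y => v (x - y) :=
  hv.integrable.aestronglyMeasurable.comp_quasiMeasurePreserving
    (Measure.measurePreserving_sub_left volume x).quasiMeasurePreserving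

lemma integrable_mul (hv : IsInteraction v) (x : E d) {g : E d → ℝ} (hg : Integrable g) :
    Integrable fun y => v (x - y) * g y := by
  obtain ⟨M, -, hM⟩ := hv.exists_bound
  exact hg.bdd_mul (hv.aestronglyMeasurable_comp_sub x) (ae_comp_sub hM x)

lemma abs_integral_le (hv : IsInteraction v) {M : ℝ} (hM : ∀ᵐ x, ‖v x‖ ≤ M) (x : E d) {g : E d → ℝ}
    (hg : Integrable g) : |∫ y, v (x - y) * g y| ≤ M * ∫ y, |g y| := by
  rw [← integral_const_mul]
  refine (abs_integral_le_integral_abs).trans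
    (integral_mono_ae (hv.integrable_mul x hg).abs (hg.abs.const_mul M) ?_)
  filter_upwards [ae_comp_sub hM x] with y hy
  rw [abs_mul]
  gcongr
  exact hy

lemma abs_convSq_le (hv : IsInteraction v) {M : ℝ} (hM : ∀ᵐ x, ‖v x‖ ≤ M) (f : L2 d) (x : E d) :
    |convSq v f x| ≤ M * ‖f‖ ^ 2 := by
  have := hv.abs_integral_le hM x (integrable_norm_sq_L2 f)
  simp only [abs_pow, abs_norm, integral_norm_sq_L2] at this
  exact this

lemma convSq_nonneg (hv : IsInteraction v) (f : L2 d) (x : E d) : 0 ≤ convSq v f x :=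
  integral_nonneg fun y => mul_nonneg (hv.nonneg _) (by positivity)

lemma aestronglyMeasurable_convSq (hv : IsInteraction v) (f : L2 d) :
    AEStronglyMeasurable (convSq v f) := by
  have h1 : AEStronglyMeasurable (fun q : E d × E d => v (q.1 - q.2)) (volume.prod volume) :=
    hv.integrable.aestronglyMeasurable.comp_quasiMeasurePreserving
      (quasiMeasurePreserving_sub_of_right_invariant volume volume)
  have h2 : AEStronglyMeasurable (fun q : E d × E d => ‖f q.2‖ ^ 2) (volume.prod volume) :=
    ((Lp.aestronglyMeasurable f).comp_snd).norm.pow 2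
  exact (h1.mul h2).integral_prod_right'

lemma memLp_convSq (hv : IsInteraction v) (f : L2 d) : MemLp (convSq v f) ⊤ := by
  obtain ⟨M, -, hM⟩ := hv.exists_bound
  exact memLp_top_of_bound (hv.aestronglyMeasurable_convSq f) (M * ‖f‖ ^ 2)
    (ae_of_all _ fun x => hv.abs_convSq_le hM f x)

lemma memLp_meanField (hv : IsInteraction v) (N : ℕ) (u : Pair d) :
    MemLp (meanField N v u) ⊤ :=
  ((hv.memLp_convSq u.fst).const_mul ((N : ℝ) - 1)).sub (memLp_top_const _)

lemma selfInteraction_nonneg (hv : IsInteraction v) (u : Pair d) : 0 ≤ selfInteraction v u := by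
  rw [selfInteraction_eq]
  exact integral_nonneg fun x => mul_nonneg (hv.convSq_nonneg _ _) (by positivity)

lemma integrable_convSq_mul (hv : IsInteraction v) (f : L2 d) {g : E d → ℝ} (hg : Integrable g) :
    Integrable fun x => convSq v f x * g x := by
  obtain ⟨M, -, hM⟩ := hv.exists_bound
  exact hg.bdd_mul (hv.aestronglyMeasurable_convSq f)
    (ae_of_all _ fun x => hv.abs_convSq_le hM f x)

lemma integral_meanField (hv : IsInteraction v) (N : ℕ) (u p : Pair d) :
    ∫ x, meanField N v u x * ‖p.fst x‖ ^ 2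
      = ((N : ℝ) - 1) * (∫ x, convSq v u.fst x * ‖p.fst x‖ ^ 2)
        - ((N : ℝ) - 1) / 2 * selfInteraction v u * ‖p.fst‖ ^ 2 := by
  rw [← integral_norm_sq_L2, ← integral_const_mul, ← integral_const_mul,
    ← integral_sub ((hv.integrable_convSq_mul _ (integrable_norm_sq_L2 _)).const_mul _)
      ((integrable_norm_sq_L2 _).const_mul _)]
  refine integral_congr_ae (ae_of_all _ fun x => ?_)
  simp only [meanField_eq]
  ring

/-- The mean-field energy of a normalized `u` is its Hartree energy. -/
lemma energy_meanField_self (hv : IsInteraction v) (N : ℕ) {u : Pair d} (hu : ‖u.fst‖ = 1) :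
    energy (meanField N v u) u = hartree N v u := by
  rw [energy_eq, hv.integral_meanField, ← selfInteraction_eq, hu, hartree, sum_integral_snd]
  ring

/-- Since `v ≥ 0` and `N ≥ 1`, the convolution part of the potential is nonnegative and only the
constant shift is kept. -/
lemma energy_meanField_ge (hv : IsInteraction v) {N : ℕ} (hN : 1 ≤ N) (u p : Pair d) :
    ‖p.snd‖ ^ 2 - ((N : ℝ) - 1) / 2 * selfInteraction v u * ‖p.fst‖ ^ 2
      ≤ energy (meanField N v u) p := by
  rw [energy_eq, hv.integral_meanField]
  have h1 : (0 : ℝ) ≤ (N : ℝ) - 1 := by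
    have : (1 : ℝ) ≤ N := by exact_mod_cast hN
    linarith
  have h2 : 0 ≤ ∫ x, convSq v u.fst x * ‖p.fst x‖ ^ 2 :=
    integral_nonneg fun x => mul_nonneg (hv.convSq_nonneg _ _) (by positivity)
  have := mul_nonneg h1 h2
  linarith

end IsInteraction

lemma hartree_eq (N : ℕ) (v : E d → ℝ) (u : Pair d) :
    hartree N v u = ‖u.snd‖ ^ 2 + ((N : ℝ) - 1) / 2 * selfInteraction v u := by
  rw [hartree, sum_integral_snd]

/-! ### Continuity of the self-interaction -/

/-- Uses `||f|² - |g|²| ≤ |f - g| (|f| + |g|)` and the weighted inequality `ab ≤ a²/(2δ) + δb²/2`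
with `δ = ‖f - g‖`, in place of Cauchy-Schwarz. -/
lemma integral_abs_norm_sq_sub_le (f g : L2 d) :
    ∫ x, |‖f x‖ ^ 2 - ‖g x‖ ^ 2| ≤ ‖f - g‖ * (1 / 2 + ‖f‖ ^ 2 + ‖g‖ ^ 2) := by
  rcases (norm_nonneg (f - g)).eq_or_lt with h0 | hpos
  · have : f = g := sub_eq_zero.1 (norm_eq_zero.1 h0.symm)
    subst this
    simp
  set δ := ‖f - g‖ with hδ
  have hR : δ * (1 / 2 + ‖f‖ ^ 2 + ‖g‖ ^ 2)
      = ∫ x, (1 / (2 * δ) * ‖(f - g) x‖ ^ 2 + (δ * ‖f x‖ ^ 2 + δ * ‖g x‖ ^ 2)) := by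
    have h1 : Integrable fun x => δ * ‖f x‖ ^ 2 + δ * ‖g x‖ ^ 2 :=
      ((integrable_norm_sq_L2 f).const_mul _).add ((integrable_norm_sq_L2 g).const_mul _)
    rw [integral_add ((integrable_norm_sq_L2 _).const_mul _) h1,
      integral_add ((integrable_norm_sq_L2 f).const_mul _) ((integrable_norm_sq_L2 g).const_mul _),
      integral_const_mul, integral_const_mul, integral_const_mul, integral_norm_sq_L2,
      integral_norm_sq_L2, integral_norm_sq_L2, ← hδ]
    field_simp
    ring
  rw [hR]
  refine integral_mono_ae ((integrable_norm_sq_L2 f).sub (integrable_norm_sq_L2 g)).abs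
    (((integrable_norm_sq_L2 _).const_mul _).add
      (((integrable_norm_sq_L2 f).const_mul _).add ((integrable_norm_sq_L2 g).const_mul _))) ?_
  filter_upwards [Lp.coeFn_sub f g] with x hx
  rw [hx, Pi.sub_apply]
  have h1 : |‖f x‖ ^ 2 - ‖g x‖ ^ 2| ≤ ‖f x - g x‖ * (‖f x‖ + ‖g x‖) := by
    rw [sq_sub_sq, abs_mul, abs_of_nonneg (by positivity : 0 ≤ ‖f x‖ + ‖g x‖), mul_comm]
    gcongr
    exact abs_norm_sub_norm_le _ _
  have h2 : ‖f x - g x‖ * (‖f x‖ + ‖g x‖)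
      ≤ 1 / (2 * δ) * ‖f x - g x‖ ^ 2 + δ / 2 * (‖f x‖ + ‖g x‖) ^ 2 := by
    have h3 : 1 / (2 * δ) * ‖f x - g x‖ ^ 2 + δ / 2 * (‖f x‖ + ‖g x‖) ^ 2
        - ‖f x - g x‖ * (‖f x‖ + ‖g x‖)
        = 1 / (2 * δ) * (‖f x - g x‖ - δ * (‖f x‖ + ‖g x‖)) ^ 2 := by
      field_simp
      ring
    have h4 : 0 ≤ 1 / (2 * δ) * (‖f x - g x‖ - δ * (‖f x‖ + ‖g x‖)) ^ 2 := by positivity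
    linarith
  have h5 : (‖f x‖ + ‖g x‖) ^ 2 ≤ 2 * (‖f x‖ ^ 2 + ‖g x‖ ^ 2) := by
    nlinarith [sq_nonneg (‖f x‖ - ‖g x‖)]
  have h6 := mul_le_mul_of_nonneg_left h5 (by positivity : 0 ≤ δ / 2)
  linarith

/-- The difference is telescoped into a change of density and a change of potential. As `v` is
bounded, each is controlled by the `L^1` distance of the densities. -/
lemma IsInteraction.abs_integral_convSq_sub_le {v : E d → ℝ} (hv : IsInteraction v) {M : ℝ}
    (hM : ∀ᵐ x, ‖v x‖ ≤ M) (f g : L2 d) :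
    |(∫ x, convSq v f x * ‖f x‖ ^ 2) - ∫ x, convSq v g x * ‖g x‖ ^ 2|
      ≤ M * (‖f‖ ^ 2 + ‖g‖ ^ 2) * ∫ x, |‖f x‖ ^ 2 - ‖g x‖ ^ 2| := by
  have hi : Integrable fun x => ‖f x‖ ^ 2 - ‖g x‖ ^ 2 :=
    (integrable_norm_sq_L2 f).sub (integrable_norm_sq_L2 g)
  set D := ∫ x, |‖f x‖ ^ 2 - ‖g x‖ ^ 2| with hD
  have hdiff : ∀ x, |convSq v f x - convSq v g x| ≤ M * D := by
    intro x
    have h1 : convSq v f x - convSq v g x = ∫ y, v (x - y) * (‖f y‖ ^ 2 - ‖g y‖ ^ 2) := by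
      rw [convSq, convSq, ← integral_sub (hv.integrable_mul x (integrable_norm_sq_L2 f))
        (hv.integrable_mul x (integrable_norm_sq_L2 g))]
      refine integral_congr_ae (ae_of_all _ fun y => ?_)
      simp only
      ring
    rw [h1]
    exact hv.abs_integral_le hM x hi
  rw [← integral_sub (hv.integrable_convSq_mul f (integrable_norm_sq_L2 f))
    (hv.integrable_convSq_mul g (integrable_norm_sq_L2 g))]
  have hR : M * (‖f‖ ^ 2 + ‖g‖ ^ 2) * D
      = ∫ x, (M * ‖f‖ ^ 2 * |‖f x‖ ^ 2 - ‖g x‖ ^ 2| + M * D * ‖g x‖ ^ 2) := by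
    rw [integral_add (hi.abs.const_mul _) ((integrable_norm_sq_L2 g).const_mul _),
      integral_const_mul, integral_const_mul, integral_norm_sq_L2]
    ring
  rw [hR]
  refine (abs_integral_le_integral_abs).trans (integral_mono
    ((hv.integrable_convSq_mul f (integrable_norm_sq_L2 f)).sub
      (hv.integrable_convSq_mul g (integrable_norm_sq_L2 g))).abs
    ((hi.abs.const_mul _).add ((integrable_norm_sq_L2 g).const_mul _)) fun x => ?_)
  have h1 : convSq v f x * ‖f x‖ ^ 2 - convSq v g x * ‖g x‖ ^ 2
      = convSq v f x * (‖f x‖ ^ 2 - ‖g x‖ ^ 2) + (convSq v f x - convSq v g x) * ‖g x‖ ^ 2 := by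
    ring
  simp only
  rw [h1]
  refine (abs_add_le _ _).trans ?_
  rw [abs_mul, abs_mul, abs_of_nonneg (sq_nonneg ‖g x‖)]
  gcongr
  · exact hv.abs_convSq_le hM f x
  · exact hdiff x

lemma IsInteraction.continuous_integral_convSq {v : E d → ℝ} (hv : IsInteraction v) :
    Continuous fun f : L2 d => ∫ x, convSq v f x * ‖f x‖ ^ 2 := by
  obtain ⟨M, hM0, hM⟩ := hv.exists_bound
  rw [continuous_iff_continuousAt]
  intro f
  rw [ContinuousAt, tendsto_iff_norm_sub_tendsto_zero]
  refine squeeze_zero (fun g => norm_nonneg _)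
    (g := fun g => M * (‖g‖ ^ 2 + ‖f‖ ^ 2) * (‖g - f‖ * (1 / 2 + ‖g‖ ^ 2 + ‖f‖ ^ 2)))
    (fun g => ?_) ?_
  · refine (hv.abs_integral_convSq_sub_le hM g f).trans ?_
    gcongr
    exact integral_abs_norm_sq_sub_le g f
  · have : Continuous fun g : L2 d =>
        M * (‖g‖ ^ 2 + ‖f‖ ^ 2) * (‖g - f‖ * (1 / 2 + ‖g‖ ^ 2 + ‖f‖ ^ 2)) := by fun_prop
    simpa using this.tendsto f

/-- Existence of Hartree minimizers on a bounded set. -/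
theorem IsInteraction.exists_isHartreeMinimizer {v : E d → ℝ} (hv : IsInteraction v) {N : ℕ}
    (hN : 1 ≤ N) {C : Set (E d)} (hC : MeasurableSet C) (hf : volume C ≠ ⊤)
    (hne : ∃ p ∈ H10 C, ‖p.fst‖ = 1) : ∃ u, IsHartreeMinimizer N v C u := by
  have hN' : (0 : ℝ) ≤ ((N : ℝ) - 1) / 2 := by
    have : (1 : ℝ) ≤ N := by exact_mod_cast hN
    linarith
  obtain ⟨u, hu, hu1, hmin⟩ := exists_minimizer hC hf
    (J := fun f => ((N : ℝ) - 1) / 2 * ∫ x, convSq v f x * ‖f x‖ ^ 2)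
    (continuous_const.mul hv.continuous_integral_convSq) (B := 0)
    (fun f _ => mul_nonneg hN' (integral_nonneg fun x =>
      mul_nonneg (hv.convSq_nonneg _ _) (by positivity))) hne
  refine ⟨u, hu, hu1, fun ψ hψ hψ1 => ?_⟩
  rw [hartree_eq, hartree_eq, selfInteraction_eq, selfInteraction_eq]
  exact hmin ψ hψ hψ1

/-- Young's inequality for the self-interaction. -/
theorem IsInteraction.selfInteraction_le {v : E d → ℝ} (hv : IsInteraction v) {u : Pair d} {K : ℝ}
    (hK0 : 0 ≤ K) (hK : ∫⁻ x, ENNReal.ofReal (‖u.fst x‖ ^ 4) ≤ ENNReal.ofReal K) :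
    selfInteraction v u ≤ (∫ x, ‖v x‖) * K := by
  set a : E d → ENNReal := fun x => ENNReal.ofReal (‖u.fst x‖ ^ 4) with ha
  set V : E d → ENNReal := fun x => ‖v x‖ₑ with hV
  have hVfin : ∫⁻ x, V x = ENNReal.ofReal (∫ x, ‖v x‖) :=
    (ofReal_integral_norm_eq_lintegral_enorm hv.integrable).symm
  -- Pointwise `|u(x)|²|u(y)|² ≤ (|u(x)|⁴ + |u(y)|⁴)/2`; each half then integrates to `‖v‖_1 ‖u‖_4^4
  -- / 2`.
  have hpt : ∀ x y : E d, ‖v (x - y) * ‖u.fst x‖ ^ 2 * ‖u.fst y‖ ^ 2‖ₑ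
      ≤ V (x - y) * a x / 2 + V (x - y) * a y / 2 := by
    intro x y
    have h1 : ‖v (x - y) * ‖u.fst x‖ ^ 2 * ‖u.fst y‖ ^ 2‖
        ≤ ‖v (x - y)‖ * ((‖u.fst x‖ ^ 4 + ‖u.fst y‖ ^ 4) / 2) := by
      rw [norm_mul, norm_mul, norm_pow, norm_pow, norm_norm, norm_norm, mul_assoc]
      gcongr
      nlinarith [sq_nonneg (‖u.fst x‖ ^ 2 - ‖u.fst y‖ ^ 2)]
    rw [← ofReal_norm]
    refine (ENNReal.ofReal_le_ofReal h1).trans (le_of_eq ?_)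
    rw [ENNReal.ofReal_mul (norm_nonneg _), ofReal_norm,
      ENNReal.ofReal_div_of_pos two_pos, ENNReal.ofReal_add (by positivity) (by positivity),
      ENNReal.ofReal_ofNat, ← ENNReal.add_div, ← mul_add, mul_div_assoc]
  have hVm : AEMeasurable (fun q : E d × E d => V (q.1 - q.2)) (volume.prod volume) :=
    (hv.integrable.aestronglyMeasurable.comp_quasiMeasurePreserving
      (quasiMeasurePreserving_sub_of_right_invariant volume volume)).enorm
  have ham : AEMeasurable a := (((Lp.aestronglyMeasurable u.fst).norm.pow 4).aemeasurable).ennreal_ofReal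
  have hVm1 : ∀ x, AEMeasurable fun y => V (x - y) := fun x =>
    (hv.aestronglyMeasurable_comp_sub x).enorm
  have hA : ∫⁻ x, ∫⁻ y, V (x - y) * a x / 2 = (∫⁻ x, V x) * (∫⁻ x, a x) / 2 := by
    have h1 : ∀ x, ∫⁻ y, V (x - y) * a x / 2 = (∫⁻ x, V x) * a x / 2 := fun x => by
      simp only [mul_div_assoc]
      rw [lintegral_mul_const'' _ (hVm1 x), lintegral_sub_left_eq_self (fun z => V z) x]
    simp only [h1]
    simp only [mul_div_assoc]
    rw [lintegral_const_mul'' _ (ham.div_const 2)]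
    simp only [div_eq_mul_inv]
    rw [lintegral_mul_const'' _ ham]
  have hB : ∫⁻ x, ∫⁻ y, V (x - y) * a y / 2 = (∫⁻ x, V x) * (∫⁻ x, a x) / 2 := by
    rw [lintegral_lintegral_swap ((hVm.mul (ham.comp_quasiMeasurePreserving
      Measure.quasiMeasurePreserving_snd)).div_const 2)]
    rw [← hA]
    refine lintegral_congr fun y => lintegral_congr fun x => ?_
    congr 2
    simp only [hV]
    -- After the order of integration is exchanged, evenness of `v` identifies the second half with
    -- the first.
    rw [← hv.even (x - y), neg_sub]
  have hmain : ‖selfInteraction v u‖ₑ ≤ ENNReal.ofReal ((∫ x, ‖v x‖) * K) := by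
    calc ‖selfInteraction v u‖ₑ
        ≤ ∫⁻ x, ‖∫ y, v (x - y) * ‖u.fst x‖ ^ 2 * ‖u.fst y‖ ^ 2‖ₑ :=
          enorm_integral_le_lintegral_enorm _
      _ ≤ ∫⁻ x, ∫⁻ y, ‖v (x - y) * ‖u.fst x‖ ^ 2 * ‖u.fst y‖ ^ 2‖ₑ :=
          lintegral_mono fun x => enorm_integral_le_lintegral_enorm _
      _ ≤ ∫⁻ x, ∫⁻ y, (V (x - y) * a x / 2 + V (x - y) * a y / 2) :=
          lintegral_mono fun x => lintegral_mono fun y => hpt x y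
      _ = ∫⁻ x, ((∫⁻ y, V (x - y) * a x / 2) + ∫⁻ y, V (x - y) * a y / 2) :=
          lintegral_congr fun x => lintegral_add_left' (((hVm1 x).mul_const _).div_const _) _
      _ = (∫⁻ x, ∫⁻ y, V (x - y) * a x / 2) + ∫⁻ x, ∫⁻ y, V (x - y) * a y / 2 := by
          refine lintegral_add_left' ?_ _
          exact ((hVm.mul (ham.comp_quasiMeasurePreserving
            Measure.quasiMeasurePreserving_fst)).div_const 2).lintegral_prod_right'
      _ = (∫⁻ x, V x) * (∫⁻ x, a x) := by rw [hA, hB, ENNReal.add_halves]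
      _ ≤ ENNReal.ofReal (∫ x, ‖v x‖) * ENNReal.ofReal K := by rw [hVfin]; gcongr
      _ = _ := (ENNReal.ofReal_mul (integral_nonneg fun x => norm_nonneg _)).symm
  rw [← ofReal_norm] at hmain
  have h0 : 0 ≤ (∫ x, ‖v x‖) * K := mul_nonneg (integral_nonneg fun x => norm_nonneg _) hK0
  exact (le_abs_self _).trans ((ENNReal.ofReal_le_ofReal_iff h0).1 hmain)

/-! ### Geometry of the vacancy set -/

lemma isOpen_box (d : ℕ) (ρ : ℝ) (N : ℕ) : IsOpen (box d ρ N) := by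
  have : box d ρ N = ⋂ i : Fin d, (fun x : E d => x i) ⁻¹'
      Set.Ioo (-(ρ ^ (-1 / (d : ℝ)) * (N : ℝ) ^ (1 / (d : ℝ))) / 2)
        ((ρ ^ (-1 / (d : ℝ)) * (N : ℝ) ^ (1 / (d : ℝ))) / 2) := by
    ext x; simp [box]
  rw [this]
  exact isOpen_iInter_of_finite fun i => isOpen_Ioo.preimage (by fun_prop)

lemma isBounded_box (d : ℕ) (ρ : ℝ) (N : ℕ) : Bornology.IsBounded (box d ρ N) := by
  set l := (ρ ^ (-1 / (d : ℝ)) * (N : ℝ) ^ (1 / (d : ℝ))) / 2 with hl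
  refine (Metric.isBounded_closedBall (x := (0 : E d)) (r := √(∑ _i : Fin d, l ^ 2))).subset
    fun x hx => ?_
  rw [mem_closedBall_zero_iff, EuclideanSpace.norm_eq]
  refine Real.sqrt_le_sqrt (Finset.sum_le_sum fun i _ => ?_)
  have h := hx i
  rw [neg_div, ← hl] at h
  rw [Real.norm_eq_abs, sq_abs]
  exact sq_le_sq' h.1.le h.2.le

/-- Only points within distance `r` of the box can matter. Local finiteness leaves finitely many of
them, and a finite union of closed balls is closed. -/
lemma isOpen_vacancySet (ρ : ℝ) (N : ℕ) (r : ℝ) {S : Set (E d)}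
    (hS : ∀ B : Set (E d), Bornology.IsBounded B → (S ∩ B).Finite) :
    IsOpen (vacancySet ρ N r S) := by
  set B := Metric.cthickening r (box d ρ N) with hB
  have hfin := hS B (isBounded_box d ρ N).cthickening
  have heq : vacancySet ρ N r S = box d ρ N \ ⋃ p ∈ S ∩ B, Metric.closedBall p r := by
    ext x
    simp only [vacancySet, Set.mem_sdiff, Set.mem_iUnion, not_exists]
    refine and_congr_right fun hx => ⟨fun h p hp => h p hp.1, fun h p hp hxp => ?_⟩
    refine h p ⟨hp, ?_⟩ hxp
    exact Metric.mem_cthickening_of_dist_le p x r _ hx (by rwa [dist_comm])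
  rw [heq]
  exact (isOpen_box d ρ N).sdiff (hfin.isClosed_biUnion fun p _ => Metric.isClosed_closedBall)

lemma volume_vacancySet_ne_top (ρ : ℝ) (N : ℕ) (r : ℝ) (S : Set (E d)) :
    volume (vacancySet ρ N r S) ≠ ⊤ :=
  ((isBounded_box d ρ N).subset Set.sdiff_subset).measure_lt_top.ne

section components

variable {U C C' : Set (E d)}

lemma isOpen_of_mem_components (hU : IsOpen U) (hC : C ∈ components U) : IsOpen C := by
  obtain ⟨x, -, rfl⟩ := hC
  exact hU.connectedComponentIn

lemma subset_of_mem_components (hC : C ∈ components U) : C ⊆ U := by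
  obtain ⟨x, -, rfl⟩ := hC
  exact connectedComponentIn_subset U x

lemma disjoint_of_mem_components (hC : C ∈ components U) (hC' : C' ∈ components U) (h : C ≠ C') :
    Disjoint C C' := by
  obtain ⟨x, hx, rfl⟩ := hC
  obtain ⟨y, hy, rfl⟩ := hC'
  rw [Set.disjoint_left]
  exact fun z hz hz' => h ((connectedComponentIn_eq hz).trans (connectedComponentIn_eq hz').symm)

lemma isOpen_diff_of_mem_components (hU : IsOpen U) (hC : C ∈ components U) : IsOpen (U \ C) := by
  rw [isOpen_iff_mem_nhds]
  rintro x ⟨hxU, hxC⟩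
  have hx : connectedComponentIn U x ∈ components U := ⟨x, hxU, rfl⟩
  have hmem := mem_connectedComponentIn hxU
  refine mem_of_superset ((isOpen_of_mem_components hU hx).mem_nhds hmem) fun y hy =>
    ⟨subset_of_mem_components hx hy, fun hyC => ?_⟩
  have hne : C ≠ connectedComponentIn U x := fun h => hxC (h ▸ hmem)
  exact (disjoint_of_mem_components hC hx hne).le_bot ⟨hyC, hy⟩

lemma countable_components (hU : IsOpen U) : (components U).Countable := by
  refine Set.PairwiseDisjoint.countable_of_isOpen (s := id) (a := components U)
    (fun C hC C' hC' h => disjoint_of_mem_components hC hC' h)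
    (fun C hC => isOpen_of_mem_components hU hC) ?_
  rintro _ ⟨x, hx, rfl⟩
  exact ⟨x, mem_connectedComponentIn hx⟩

end components

/-! ### Eigenvectors and decompositions of the domain -/

lemma exists_unit_of_fst_ne_zero {U : Set (E d)} {p : Pair d} (hp : p ∈ H10 U) (h : p.fst ≠ 0) :
    ∃ c : ℂ, c ≠ 0 ∧ c • p ∈ H10 U ∧ ‖(c • p).fst‖ = 1 := by
  have hpos : 0 < ‖p.fst‖ := norm_pos_iff.2 h
  refine ⟨((‖p.fst‖⁻¹ : ℝ) : ℂ), by exact_mod_cast inv_ne_zero hpos.ne', (H10 U).smul_mem _ hp, ?_⟩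
  rw [WithLp.smul_fst, norm_smul, Complex.norm_real, norm_inv, norm_norm]
  exact inv_mul_cancel₀ hpos.ne'

lemma exists_unit_mem_H10 {U : Set (E d)} (hU : IsOpen U) (hne : U.Nonempty) :
    ∃ p ∈ H10 U, ‖p.fst‖ = 1 := by
  obtain ⟨x, hx⟩ := hne
  obtain ⟨f, h1, h2, h3, -, h5⟩ :=
    exists_contDiff_tsupport_subset (n := (⊤ : ℕ∞)) (hU.mem_nhds hx)
  have hsm : ContDiff ℝ ((⊤ : ℕ∞) : WithTop ℕ∞) fun y => (f y : ℂ) :=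
    Complex.ofRealCLM.contDiff.comp h3
  have hsupp : HasCompactSupport fun y => (f y : ℂ) :=
    h2.comp_left (g := fun t : ℝ => (t : ℂ)) Complex.ofReal_zero
  have hts : tsupport (fun y => (f y : ℂ)) ⊆ U :=
    (closure_mono (Function.support_comp_subset (g := fun t : ℝ => (t : ℂ)) Complex.ofReal_zero
      f)).trans h1
  have hmem := (isTestPair_testPair hsm hsupp hts).mem_H10
  have hnz : (testPair _ hsm hsupp).fst ≠ 0 := by
    intro h0
    have h6 := testPair_fst _ hsm hsupp
    rw [h0] at h6
    have h7 : (fun y => (f y : ℂ)) =ᵐ[volume] fun _ => (0 : ℂ) :=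
      h6.symm.trans (Lp.coeFn_zero ℂ 2 (volume : Measure (E d)))
    have h8 := (Continuous.ae_eq_iff_eq volume hsm.continuous continuous_const).1 h7
    have h9 := congrFun h8 x
    simp [h5] at h9
  obtain ⟨c, -, hc1, hc2⟩ := exists_unit_of_fst_ne_zero hmem hnz
  exact ⟨_, hc1, hc2⟩

lemma IsEigenvector.smul {U : Set (E d)} {W : E d → ℝ} (hW : MemLp W ⊤) {μ : ℝ} {p : Pair d}
    (h : IsEigenvector U W μ p) (c : ℂ) : IsEigenvector U W μ (c • p) := by
  refine ⟨(H10 U).smul_mem c h.1, fun χ hχ => ?_⟩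
  rw [form_smul_right hW, h.2 χ hχ, ← inner_L2_eq, ← inner_L2_eq, WithLp.smul_fst,
    inner_smul_right]
  ring

/-- Restrictions of eigenvectors to a clopen part of the domain are eigenvectors. -/
lemma IsEigenvector.cut {U A B : Set (E d)} {W : E d → ℝ} (hA : IsOpen A) (hB : IsOpen B)
    (hAB : Disjoint A B) (hU : U = A ∪ B) {μ : ℝ} {p : Pair d} (h : IsEigenvector U W μ p) :
    IsEigenvector U W μ (cut A hA.measurableSet p) := by
  have hAU : A ⊆ U := hU ▸ Set.subset_union_left
  refine ⟨H10_mono hAU (cut_mem_H10 hA hB hAB hU.subset h.1), fun χ hχ => ?_⟩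
  rw [← form_cut, h.2 _ (H10_mono hAU (cut_mem_H10 hA hB hAB hU.subset hχ)), ← inner_L2_eq,
    ← inner_L2_eq, cut_fst_eq, cut_fst_eq,
    inner_mulL_indicator hA.measurableSet]

/-- Eigenvectors of a clopen part of the domain are eigenvectors. -/
lemma IsEigenvector.extend {U A B : Set (E d)} {W : E d → ℝ} (hA : IsOpen A) (hB : IsOpen B)
    (hAB : Disjoint A B) (hU : U = A ∪ B) {μ : ℝ} {p : Pair d} (h : IsEigenvector A W μ p) :
    IsEigenvector U W μ p := by
  have hAU : A ⊆ U := hU ▸ Set.subset_union_left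
  refine ⟨H10_mono hAU h.1, fun χ hχ => ?_⟩
  have hp := cut_eq_self hA.measurableSet subset_rfl h.1
  rw [← hp, ← form_cut, h.2 _ (cut_mem_H10 hA hB hAB hU.subset hχ), ← inner_L2_eq,
    ← inner_L2_eq, cut_fst_eq, cut_fst_eq,
    inner_mulL_indicator hA.measurableSet]

lemma linearIndependent_of_disjoint {A B : Set (E d)} (hA : MeasurableSet A) (hB : MeasurableSet B)
    (hAB : Disjoint A B) {p q : Pair d} (hp : p ∈ H10 A) (hq : q ∈ H10 B) (hp0 : p ≠ 0)
    (hq0 : q ≠ 0) : LinearIndependent ℂ ![p, q] := by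
  rw [LinearIndependent.pair_iff]
  intro s t hst
  have h1 : cut A hA q = 0 := by
    rw [← cut_eq_self hB subset_rfl hq, cut_cut_of_disjoint hA hB hAB]
  have h2 := congrArg (cut A hA) hst
  rw [map_add, map_smul, map_smul, h1, cut_eq_self hA subset_rfl hp, smul_zero, add_zero,
    map_zero] at h2
  have hs : s = 0 := (smul_eq_zero.1 h2).resolve_right hp0
  rw [hs, zero_smul, zero_add] at hst
  exact ⟨hs, (smul_eq_zero.1 hst).resolve_right hq0⟩

/-! ### Ground components: existence, uniqueness and the second eigenvalue -/

/-- A ground state carried by a component, as an element of `H^1_0` of that component. -/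
lemma IsGroundComponent.exists_ground_mem {U C : Set (E d)} (hU : IsOpen U)
    (hC : IsGroundComponent U C) :
    ∃ φ ∈ H10 C, IsEigenvector U (fun _ => 0) (laplacianEigenvalue U 1) φ ∧ ‖φ.fst‖ = 1 := by
  obtain ⟨hc, φ, ⟨hφ, hφ1⟩, hz⟩ := hC
  have hCo := isOpen_of_mem_components hU hc
  have hDo := isOpen_diff_of_mem_components hU hc
  have hun : U = C ∪ U \ C := (Set.union_sdiff_cancel (subset_of_mem_components hc)).symm
  refine ⟨cut C hCo.measurableSet φ, cut_mem_H10 hCo hDo Set.disjoint_sdiff_right hun.subset hφ.1,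
    hφ.cut hCo hDo Set.disjoint_sdiff_right hun, ?_⟩
  have : (cut C hCo.measurableSet φ).fst = φ.fst := by
    refine Lp.ext ?_
    filter_upwards [cut_fst hCo.measurableSet φ, hz] with x h1 h2
    rw [h1]
    by_cases hx : x ∈ C
    · rw [Set.indicator_of_mem hx]
    · rw [Set.indicator_of_notMem hx, h2 hx]
  rw [this, hφ1]

lemma Pair.ne_zero_of_norm_fst {p : Pair d} (h : ‖p.fst‖ = 1) : p ≠ 0 := by
  rintro rfl
  simp at h

/-- Cutting a ground state to a component gives an eigenvector for the same eigenvalue or zero. If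
every cut were zero, countability of the components would make the ground state vanish almost
everywhere. -/
theorem exists_isGroundComponent {U : Set (E d)} (hU : IsOpen U) (hf : volume U ≠ ⊤)
    (hne : U.Nonempty) : ∃ C, IsGroundComponent U C := by
  obtain ⟨φ, hφ, hφ1, -, heig, -⟩ := exists_ground hU.measurableSet hf memLp_zero_potential
    (exists_unit_mem_H10 hU hne)
  by_contra hcon
  push Not at hcon
  have hzero : ∀ C ∈ components U, ∀ᵐ x, x ∈ C → φ.fst x = 0 := by
    intro C hc
    have hCo := isOpen_of_mem_components hU hc
    have hDo := isOpen_diff_of_mem_components hU hc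
    have hun : U = C ∪ U \ C := (Set.union_sdiff_cancel (subset_of_mem_components hc)).symm
    have hmem := cut_mem_H10 hCo hDo Set.disjoint_sdiff_right hun.subset hφ
    have h0 : (cut C hCo.measurableSet φ).fst = 0 := by
      by_contra hnz
      obtain ⟨c, -, hc1, hc2⟩ := exists_unit_of_fst_ne_zero hmem hnz
      exact hcon C ⟨hc, _, ⟨(heig.cut hCo hDo Set.disjoint_sdiff_right hun).smul
        memLp_zero_potential c, hc2⟩, fst_eq_zero_of_notMem hCo.measurableSet hc1⟩
    have h1 := cut_fst hCo.measurableSet φ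
    rw [h0] at h1
    filter_upwards [h1, Lp.coeFn_zero ℂ 2 (volume : Measure (E d))] with x e1 e2 hx
    rw [Set.indicator_of_mem hx, e2] at e1
    exact e1.symm
  have hall := (ae_ball_iff (countable_components hU)).2 hzero
  have hφ0 : φ.fst = 0 := by
    refine Lp.ext ?_
    filter_upwards [hall, fst_eq_zero_of_notMem hU.measurableSet hφ,
      Lp.coeFn_zero ℂ 2 (volume : Measure (E d))] with x h1 h2 h3
    rw [h3]
    by_cases hx : x ∈ U
    · exact h1 _ ⟨x, hx, rfl⟩ (mem_connectedComponentIn hx)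
    · exact h2 hx
  rw [hφ0, norm_zero] at hφ1
  exact zero_ne_one hφ1

/-- Ground states on two distinct components have disjoint supports and are thus independent, which
closes the gap. -/
theorem existsUnique_isGroundComponent {U : Set (E d)} (hU : IsOpen U) (hf : volume U ≠ ⊤)
    (hne : U.Nonempty) (hgap : laplacianEigenvalue U 1 < laplacianEigenvalue U 2) :
    ∃! C, IsGroundComponent U C := by
  obtain ⟨C, hC⟩ := exists_isGroundComponent hU hf hne
  refine ⟨C, hC, fun C' hC' => ?_⟩
  by_contra hcon
  obtain ⟨p, hp, hpe, hp1⟩ := hC.exists_ground_mem hU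
  obtain ⟨q, hq, hqe, hq1⟩ := hC'.exists_ground_mem hU
  have hli := linearIndependent_of_disjoint (isOpen_of_mem_components hU hC'.1).measurableSet
    (isOpen_of_mem_components hU hC.1).measurableSet (disjoint_of_mem_components hC'.1 hC.1 hcon)
    hq hp (Pair.ne_zero_of_norm_fst hq1) (Pair.ne_zero_of_norm_fst hp1)
  exact hgap.not_ge (laplacianEigenvalue_two_le hli hqe hpe le_rfl le_rfl)

/-- Outside the ground component the Dirichlet energy is at least the second eigenvalue. -/
lemma second_eigenvalue_le {U C : Set (E d)} (hU : IsOpen U) (hf : volume U ≠ ⊤)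
    (hgap : laplacianEigenvalue U 1 < laplacianEigenvalue U 2) (hC : IsGroundComponent U C)
    {q : Pair d} (hq : q ∈ H10 (U \ C)) :
    laplacianEigenvalue U 2 * ‖q.fst‖ ^ 2 ≤ ‖q.snd‖ ^ 2 := by
  by_cases h0 : q.fst = 0
  · rw [h0, norm_zero]
    nlinarith [sq_nonneg ‖q.snd‖]
  obtain ⟨c, -, hc1, hc2⟩ := exists_unit_of_fst_ne_zero hq h0
  have hCo := isOpen_of_mem_components hU hC.1
  have hDo := isOpen_diff_of_mem_components hU hC.1
  have hun : U = U \ C ∪ C := (Set.sdiff_union_of_subset (subset_of_mem_components hC.1)).symm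
  have hfD : volume (U \ C) ≠ ⊤ := (measure_mono Set.sdiff_subset).trans_lt hf.lt_top |>.ne
  obtain ⟨χ, hχ, hχ1, -, hχe, hmin⟩ :=
    exists_ground hDo.measurableSet hfD memLp_zero_potential ⟨_, hc1, hc2⟩
  obtain ⟨p, hp, hpe, hp1⟩ := hC.exists_ground_mem hU
  have hli := linearIndependent_of_disjoint hCo.measurableSet hDo.measurableSet
    Set.disjoint_sdiff_right hp hχ (Pair.ne_zero_of_norm_fst hp1) (Pair.ne_zero_of_norm_fst hχ1)
  -- The lowest eigenfunction on `U \ C`, extended by zero, and the ground state on `C` are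
  -- independent. So `l₂` is at most the larger of their eigenvalues, and the gap excludes `l₁`.
  have h2 := laplacianEigenvalue_two_le hli hpe
    (hχe.extend hDo hCo Set.disjoint_sdiff_left hun) (le_max_left _ _) (le_max_right _ _)
  have h3 := (le_max_iff.1 h2).resolve_left hgap.not_ge
  have h4 := hmin q hq
  rw [energy_zero_potential] at h4
  exact (mul_le_mul_of_nonneg_right h3 (sq_nonneg _)).trans h4

lemma norm_fst_cut_add_cut {A B : Set (E d)} (hA : MeasurableSet A) (hB : MeasurableSet B)
    (hAB : Disjoint A B) (p : Pair d) :
    ‖(cut A hA p + cut B hB p).fst‖ ^ 2 = ‖(cut A hA p).fst‖ ^ 2 + ‖(cut B hB p).fst‖ ^ 2 := by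
  have h : inner ℂ (cut A hA p).fst (cut B hB p).fst = 0 := by
    rw [cut_fst_eq, inner_mulL_indicator hA, ← cut_fst_eq hA, cut_cut_of_disjoint hA hB hAB,
      WithLp.zero_fst, inner_zero_right]
  rw [WithLp.add_fst]
  have := norm_add_sq_eq_norm_sq_add_norm_sq_of_inner_eq_zero _ _ h
  simpa only [sq] using this

lemma energy_cut_add_cut {A B : Set (E d)} (hA : MeasurableSet A) (hB : MeasurableSet B)
    (hAB : Disjoint A B) {W : E d → ℝ} (hW : MemLp W ⊤) (p : Pair d) :
    energy W (cut A hA p + cut B hB p) = energy W (cut A hA p) + energy W (cut B hB p) := by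
  have h0 : form W p 0 = 0 := by
    have := form_smul_right hW 0 p 0
    simpa using this
  have h1 : form W (cut A hA p) (cut B hB p) = 0 := by
    rw [form_cut, cut_cut_of_disjoint hA hB hAB, h0]
  have h2 : form W (cut B hB p) (cut A hA p) = 0 := by
    rw [form_cut, cut_cut_of_disjoint hB hA hAB.symm, h0]
  have h3 : ((energy W (cut A hA p + cut B hB p) : ℝ) : ℂ)
      = ((energy W (cut A hA p) + energy W (cut B hB p) : ℝ) : ℂ) := by
    push_cast
    simp only [← form_self, form_add_left hW, form_add_right hW, h1, h2]
    ring
  exact_mod_cast h3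

/-! ### The ground state of the mean-field operator -/

/-- `C1 d ^ 2 = 4 e² (4π)^(-d/2)`, so the `L^4` bound fits with room to spare: a factor 4, and `6π`
against `4π`. -/
lemma exp_two_mul_le (d : ℕ) {lam : ℝ} (h : 0 ≤ lam) :
    Real.exp 2 * (lam / (6 * Real.pi)) ^ ((d : ℝ) / 2) ≤ C1 d ^ 2 * lam ^ ((d : ℝ) / 2) := by
  have hpi := Real.pi_pos
  have h1 : C1 d ^ 2 = 4 * Real.exp 2 * (4 * Real.pi) ^ (-((d : ℝ) / 2)) := by
    have e1 : ((4 * Real.pi) ^ (-(d : ℝ) / 4)) ^ 2 = (4 * Real.pi) ^ (-((d : ℝ) / 2)) := by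
      rw [← Real.rpow_natCast, ← Real.rpow_mul (by positivity)]
      congr 1
      push_cast
      ring
    have e2 : Real.exp 1 ^ 2 = Real.exp 2 := by
      rw [← Real.exp_nat_mul]; norm_num
    rw [C1, mul_pow, mul_pow, e1, e2]
    ring
  have h2 : (lam / (6 * Real.pi)) ^ ((d : ℝ) / 2)
      ≤ (4 * Real.pi) ^ (-((d : ℝ) / 2)) * lam ^ ((d : ℝ) / 2) := by
    calc (lam / (6 * Real.pi)) ^ ((d : ℝ) / 2) ≤ (lam / (4 * Real.pi)) ^ ((d : ℝ) / 2) := by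
          gcongr
          norm_num
      _ = _ := by
          rw [Real.div_rpow h (by positivity), Real.rpow_neg (by positivity)]
          ring
  rw [h1]
  have h3 : 0 ≤ Real.exp 2 * ((4 * Real.pi) ^ (-((d : ℝ) / 2)) * lam ^ ((d : ℝ) / 2)) := by
    positivity
  have h4 := mul_le_mul_of_nonneg_left h2 (Real.exp_pos 2).le
  linarith

/-- On a ground component the mean-field operator of a Hartree minimizer has the same lowest
eigenvalue as on the whole domain. -/
theorem isLeast_energy_meanField (hd : 2 ≤ d) {U C : Set (E d)} (hU : IsOpen U)
    (hf : volume U ≠ ⊤) {N : ℕ} (hN : 1 ≤ N) {v : E d → ℝ} (hv : IsInteraction v)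
    (hgap : laplacianEigenvalue U 2 - laplacianEigenvalue U 1
      > C1 d ^ 2 * N * (∫ x, ‖v x‖) * laplacianEigenvalue U 1 ^ ((d : ℝ) / 2))
    (hgap' : laplacianEigenvalue U 1 < laplacianEigenvalue U 2)
    (hC : IsGroundComponent U C) {u : Pair d} (hu : IsHartreeMinimizer N v C u) :
    IsLeast {e : ℝ | ∃ ψ ∈ H10 U, ‖ψ.fst‖ = 1 ∧ e = energy (meanField N v u) ψ}
      (eigenvalue C (meanField N v u) 1) := by
  have hW := hv.memLp_meanField N u
  have hCU := subset_of_mem_components hC.1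
  have hCo := isOpen_of_mem_components hU hC.1
  have hDo := isOpen_diff_of_mem_components hU hC.1
  have hun : U = C ∪ U \ C := (Set.union_sdiff_cancel hCU).symm
  have hfC : volume C ≠ ⊤ := (measure_mono hCU).trans_lt hf.lt_top |>.ne
  obtain ⟨p, hp, hp1, hpe, -, hmin⟩ := exists_ground hCo.measurableSet hfC hW ⟨u, hu.1, hu.2.1⟩
  refine ⟨⟨p, H10_mono hCU hp, hp1, hpe.symm⟩, ?_⟩
  set e := eigenvalue C (meanField N v u) 1 with he
  set l₁ := laplacianEigenvalue U 1 with hl1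
  set l₂ := laplacianEigenvalue U 2 with hl2
  obtain ⟨φ, hφ, hφe, hφ1⟩ := hC.exists_ground_mem hU
  rw [← hl1] at hφe
  have hl1pos : 0 < l₁ := hφe.eigenvalue_pos hd hU.measurableSet hf hφ1
  have hN' : (1 : ℝ) ≤ N := by exact_mod_cast hN
  have hK := lintegral_norm_pow_four_le hd hU.measurableSet hf hφe hφ1
  have hSI := hv.selfInteraction_le (by positivity) hK
  have hv0 : 0 ≤ ∫ x, ‖v x‖ := integral_nonneg fun x => norm_nonneg _
  -- The gap condition is spent here, on the ground state `φ` rather than on the minimizer `u`.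
  have hSI' : ((N : ℝ) - 1) * selfInteraction v φ < l₂ - l₁ := by
    refine lt_of_le_of_lt ?_ hgap
    calc ((N : ℝ) - 1) * selfInteraction v φ
        ≤ N * ((∫ x, ‖v x‖) * (C1 d ^ 2 * l₁ ^ ((d : ℝ) / 2))) := by
          refine mul_le_mul (by linarith) (hSI.trans ?_) (hv.selfInteraction_nonneg φ)
            (by positivity)
          exact mul_le_mul_of_nonneg_left (exp_two_mul_le d hl1pos.le) hv0
      _ = _ := by ring
  have hφs : ‖φ.snd‖ ^ 2 = l₁ := (hφe.eigenvalue_eq_norm_sq hφ1).symm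
  have hHle := hu.2.2 φ hφ hφ1
  have hHu := hartree_eq N v u
  have hHφ := hartree_eq N v φ
  have hue : e ≤ hartree N v u := by
    have := hmin u hu.1
    rw [hv.energy_meanField_self N hu.2.1, hu.2.1] at this
    linarith
  have hul : l₁ ≤ ‖u.snd‖ ^ 2 := by
    obtain ⟨-, -, -, -, -, hm⟩ := exists_ground hU.measurableSet hf memLp_zero_potential
      ⟨u, H10_mono hCU hu.1, hu.2.1⟩
    have := hm u (H10_mono hCU hu.1)
    rw [energy_zero_potential, hu.2.1] at this
    simpa [hl1, laplacianEigenvalue] using this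
  rintro _ ⟨ψ, hψ, hψ1, rfl⟩
  have hsum := cut_add_cut hCo hDo Set.disjoint_sdiff_right hun.subset hψ
  have hnorm := norm_fst_cut_add_cut hCo.measurableSet hDo.measurableSet
    Set.disjoint_sdiff_right ψ
  have hen := energy_cut_add_cut hCo.measurableSet hDo.measurableSet
    Set.disjoint_sdiff_right hW ψ
  rw [hsum] at hnorm hen
  rw [hψ1] at hnorm
  have hψC := hmin _ (cut_mem_H10 hCo hDo Set.disjoint_sdiff_right hun.subset hψ)
  have hψD := cut_mem_H10 hDo hCo Set.disjoint_sdiff_left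
    (hun.subset.trans (Set.union_comm _ _).subset) hψ
  have h2 := second_eigenvalue_le hU hf hgap' hC hψD
  have h3 := hv.energy_meanField_ge hN u (cut (U \ C) hDo.measurableSet ψ)
  -- The comparison `hHle` is used twice: it bounds `e` by `l₁ + (N-1)/2 S(φ)`, and together with
  -- `hul` it bounds `(N-1)/2 S(u)` by `(N-1)/2 S(φ)`. The sum is below `l₂` by `hSI'`.
  have h4 : e ≤ l₂ - ((N : ℝ) - 1) / 2 * selfInteraction v u := by linarith
  have h5 := mul_le_mul_of_nonneg_right h4 (sq_nonneg ‖(cut (U \ C) hDo.measurableSet ψ).fst‖)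
  rw [hen]
  calc e = e * ‖(cut C hCo.measurableSet ψ).fst‖ ^ 2
        + e * ‖(cut (U \ C) hDo.measurableSet ψ).fst‖ ^ 2 := by
        rw [← mul_add, ← hnorm]; ring
    _ ≤ _ := add_le_add hψC (by linarith)

/-- An empty vacancy set has volume fraction 0, at distance at least the expected fraction, which
exceeds `η`. -/
lemma vacancySet_nonempty_of_mem_event1 {Ω : Type*} {X : Ω → Set (E d)} {ν : ℝ≥0} {ρ r η : ℝ}
    {N : ℕ} (hη' : η < vacancyFraction d ν r) {ω : Ω} (hω : ω ∈ event1 X ν ρ r η N) :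
    (vacancySet ρ N r (X ω)).Nonempty := by
  by_contra hcon
  rw [Set.not_nonempty_iff_eq_empty] at hcon
  have h : |volume.real (vacancySet ρ N r (X ω)) / volume.real (box d ρ N)
      - vacancyFraction d ν r| < η := hω
  rw [hcon, measureReal_empty, zero_div, zero_sub, abs_neg] at h
  exact absurd (h.trans hη') (le_abs_self _).not_gt

end KacLuttinger

end

/-! ### Conclusion for the Poisson vacancy set -/

theorem mainTheorem6 {d : ℕ} (hd : 2 ≤ d) {Ω : Type*} [MeasurableSpace Ω] (P : Measure Ω)
    [IsProbabilityMeasure P] (ν : ℝ≥0) (hν : 0 < ν) (X : Ω → Set (KacLuttinger.E d))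
    (hX : KacLuttinger.IsPoissonPointProcess P ν X)
    (ρ r η : ℝ) (hρ : 0 < ρ) (hr : 0 < r)
    (hη : 0 < η) (hη' : η < KacLuttinger.vacancyFraction d ν r)
    (N : ℕ) (hN : 1 ≤ N) (v : KacLuttinger.E d → ℝ) (hv : KacLuttinger.IsInteraction v)
    (ω : Ω) (hω : ω ∈ KacLuttinger.event2 X ν ρ r η N v) :
    (∃! C, KacLuttinger.IsGroundComponent (KacLuttinger.vacancySet ρ N r (X ω)) C) ∧
    ∀ C, KacLuttinger.IsGroundComponent (KacLuttinger.vacancySet ρ N r (X ω)) C →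
      (∃ u, KacLuttinger.IsHartreeMinimizer N v C u) ∧
      ∀ u, KacLuttinger.IsHartreeMinimizer N v C u →
        IsLeast {e : ℝ | ∃ ψ ∈ KacLuttinger.H10 (KacLuttinger.vacancySet ρ N r (X ω)),
            ‖ψ.fst‖ = 1 ∧ e = KacLuttinger.energy (KacLuttinger.meanField N v u) ψ}
          (KacLuttinger.eigenvalue C (KacLuttinger.meanField N v u) 1) := by
  have hU := KacLuttinger.isOpen_vacancySet ρ N r (hX.locallyFinite ω)
  have hf := KacLuttinger.volume_vacancySet_ne_top ρ N r (X ω)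
  have hne := KacLuttinger.vacancySet_nonempty_of_mem_event1 hη' hω.1
  have hgap := hω.2
  set U := KacLuttinger.vacancySet ρ N r (X ω) with hUdef
  -- The threshold in the event is nonnegative because `l₁ > 0`, so a spectral gap is present.
  have hgap' : KacLuttinger.laplacianEigenvalue U 1 < KacLuttinger.laplacianEigenvalue U 2 := by
    obtain ⟨φ, -, hφ1, -, hφe, -⟩ := KacLuttinger.exists_ground hU.measurableSet hf
      KacLuttinger.memLp_zero_potential (KacLuttinger.exists_unit_mem_H10 hU hne)
    have hpos : 0 < KacLuttinger.laplacianEigenvalue U 1 :=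
      hφe.eigenvalue_pos hd hU.measurableSet hf hφ1
    have h0 : 0 ≤ ∫ x, ‖v x‖ := integral_nonneg fun x => norm_nonneg _
    have h1 : 0 ≤ KacLuttinger.C1 d ^ 2 * N * (∫ x, ‖v x‖)
        * KacLuttinger.laplacianEigenvalue U 1 ^ ((d : ℝ) / 2) := by positivity
    linarith
  refine ⟨KacLuttinger.existsUnique_isGroundComponent hU hf hne hgap', fun C hC => ⟨?_, fun u hu =>
    KacLuttinger.isLeast_energy_meanField hd hU hf hN hv hgap hgap' hC hu⟩⟩
  obtain ⟨φ, hφ, -, hφ1⟩ := hC.exists_ground_mem hU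
  have hCU := KacLuttinger.subset_of_mem_components hC.1
  exact hv.exists_isHartreeMinimizer hN (KacLuttinger.isOpen_of_mem_components hU hC.1).measurableSet
    ((measure_mono hCU).trans_lt hf.lt_top).ne ⟨φ, hφ, hφ1⟩
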